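/- Let $(B,\mathcal H,\mu)$ be an abstract Wiener space: $\mu$ is a centred Gaussian measure on a separable real Banach space $B$ with Cameron--Martin space $\mathcal H\subset B$. Let $(e_i)$ be an orthonormal basis of $\mathcal H$ consisting of elements of $B^\star$, where $B^\star$ is mapped to $\mathcal H$ by dualising the inclusion $\mathcal H\subset B$ and identifying $\mathcal H^\star$ with $\mathcal H$. Let $H_k$ be the Hermite polynomials normalised by $\exp(\lambda x-\tfrac12\lambda^2)=\sum_{k\ge0}\frac{\lambda^k}{\sqrt{k!}}H_k(x)$ and, for a finitely supported multi-index $\alpha$ with $|\alpha|=\sum_i\alpha_i$, let $H_\alpha(\xi)=\prod_iH_{\alpha_i}(\langle\xi,e_i\rangle)$. For a separable real Banach space $E$ and $k\ge 0$, the $k$-th $E$-valued Wiener chaos $\mathcal H^{(k)}(\mu,E)$ is the closure in $L^2(\mu,E)$ of the linear span of the random variables $H_\alpha(\xi)\,y$ with $|\alpha|=k$ and $y\in E$. Let $\mathcal W$ be a finite set and, for each $\tau\in\mathcal W$, let $E_\tau$ be a separable real Banach space and $K_\tau\in\{0,1,2,\dots\}$; put $\mathbf E=\bigoplus_{\tau\in\mathcal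 W}E_\tau$. For each $\delta\in[0,1)$ let $\mathbf\Psi_\delta=\bigoplus_\tau\Psi_{\delta;\tau}$ with $\Psi_{\delta;\tau}=\sum_{k=0}^{K_\tau}\Psi_{\delta;\tau,k}$ and $\Psi_{\delta;\tau,k}\in\mathcal H^{(k)}(\mu,E_\tau)$, write $\mathbf\Psi=\mathbf\Psi_0$ (and $\Psi_{\tau,k}=\Psi_{0;\tau,k}$), and assume that for all $\tau\in\mathcal W$ and $k\le K_\tau$ $$\lim_{\delta\downarrow0}\int\|\Psi_{\delta;\tau,k}(\xi)-\Psi_{\tau,k}(\xi)\|_{E_\tau}^2\,\mu(d\xi)=0 .$$ For $h\in\mathcal H$ let $\mathbf\Psi_{\mathrm{hom}}(h)=\bigoplus_\tau\int\Psi_{\tau,K_\tau}(\xi+h)\,\mu(d\xi)$, and for $\varepsilon>0$ let $\mathbf\Psi_\delta^{(\varepsilon)}=\bigoplus_\tau\varepsilon^{K_\tau/2}\,\Psi_{\delta;\tau}$. Then for every function $\varepsilon\mapsto\delta(\varepsilon)\ge0$ with $\lim_{\varepsilon\downarrow0}\delta(\varepsilon)=0$ the random variables $\mathbf\Psi^{(\varepsilon)}_{\delta(\varepsilon)}$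 satisfy, under $\mu$, a large deviation principle on $\mathbf E$ with rate $\varepsilon$ and rate function $$\mathscr I(\mathbf s)=\inf\Big\{\tfrac12|h|_{\mathcal H}^2\ :\ h\in\mathcal H,\ \mathbf\Psi_{\mathrm{hom}}(h)=\mathbf s\Big\}\qquad(\inf\emptyset=+\infty).$$ That is, $\mathscr I:\mathbf E\to[0,+\infty]$ is lower semicontinuous, has compact sublevel sets $\{\mathscr I\le c\}$, $c<\infty$, and is not identically $+\infty$; for every closed $\mathcal C\subseteq\mathbf E$, $\limsup_{\varepsilon\downarrow0}\varepsilon\log\mu(\mathbf\Psi^{(\varepsilon)}_{\delta(\varepsilon)}\in\mathcal C)\le-\inf_{\mathcal C}\mathscr I$; and for every open $\mathcal O\subseteq\mathbf E$, $\liminf_{\varepsilon\downarrow0}\varepsilon\log\mu(\mathbf\Psi^{(\varepsilon)}_{\delta(\varepsilon)}\in\mathcal O)\ge-\inf_{\mathcal O}\mathscr I$. -/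

import Mathlib

open MeasureTheory ProbabilityTheory Filter Topology
open scoped ENNReal NNReal

noncomputable section

/-- A family `ν ε`, `ε > 0`, of probability measures satisfies a large deviation principle with
rate `ε` and (good) rate function `I`. Logarithms and infima take values in the extended reals,
so that `log 0 = -∞` and the infimum over the empty set is `+∞`. -/
structure SatisfiesLDP {S : Type*} [TopologicalSpace S] [MeasurableSpace S]
    (ν : ℝ → Measure S) (I : S → ℝ≥0∞) : Prop where
  isProbabilityMeasure : ∀ ε : ℝ, 0 < ε → IsProbabilityMeasure (ν ε)
  lowerSemicontinuous : LowerSemicontinuous I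
  isCompact_sublevel : ∀ c : ℝ≥0, IsCompact {s : S | I s ≤ c}
  exists_ne_top : ∃ s : S, I s ≠ ⊤
  upper_bound : ∀ C : Set S, IsClosed C →
    limsup (fun ε : ℝ => (ε : EReal) * ENNReal.log (ν ε C)) (𝓝[>] 0)
      ≤ -((⨅ s ∈ C, I s : ℝ≥0∞) : EReal)
  lower_bound : ∀ O : Set S, IsOpen O →
    -((⨅ s ∈ O, I s : ℝ≥0∞) : EReal)
      ≤ liminf (fun ε : ℝ => (ε : EReal) * ENNReal.log (ν ε O)) (𝓝[>] 0)

namespace WienerChaos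

section WienerSpace

variable {B H : Type*} [NormedAddCommGroup B] [NormedSpace ℝ B]
  [NormedAddCommGroup H] [InnerProductSpace ℝ H] [CompleteSpace H]

/-- The map `B⋆ → H` obtained by dualising the inclusion `j : H → B` and identifying `H⋆`
with `H`. -/
def dualToH (j : H →L[ℝ] B) (ℓ : StrongDual ℝ B) : H :=
  (InnerProductSpace.toDual ℝ H).symm (ℓ ∘L j)

/-- `(B, H, μ)` is an abstract Wiener space with inclusion `j : H ↪ B`: `μ` is a centred Gaussian
measure on `B`, and the Hilbert space `H ⊆ B` is its Cameron-Martin space, i.e. the covariance of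
`μ` is `(ℓ, ℓ') ↦ ⟪j⋆ ℓ, j⋆ ℓ'⟫_H`. -/
structure IsAbstractWienerSpace [MeasurableSpace B] (j : H →L[ℝ] B) (μ : Measure B) : Prop where
  isGaussian : IsGaussian μ
  centred : ∀ ℓ : StrongDual ℝ B, ∫ ξ, ℓ ξ ∂μ = 0
  injective : Function.Injective j
  covariance : ∀ ℓ ℓ' : StrongDual ℝ B,
    ∫ ξ, ℓ ξ * ℓ' ξ ∂μ = inner ℝ (dualToH j ℓ) (dualToH j ℓ')

end WienerSpace

/-- The Hermite polynomials, normalised to be orthonormal for the standard normal law: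
`exp (λ x - λ² / 2) = ∑ λ ^ k / √k! * H_k x`. -/
def hermiteFun (k : ℕ) (x : ℝ) : ℝ :=
  Polynomial.aeval x (Polynomial.hermite k) / √(k.factorial : ℝ)

section Chaos

variable {B : Type*} [NormedAddCommGroup B] [NormedSpace ℝ B] {ι : Type*}

/-- `H_α (ξ) = ∏ i, H_{α i} (⟨ξ, e i⟩)` for a multi-index `α`. -/
def hermiteMulti (e : ι → StrongDual ℝ B) (α : ι →₀ ℕ) (ξ : B) : ℝ :=
  α.prod fun i n => hermiteFun n (e i ξ)

/-- The `k`-th homogeneous `F`-valued Wiener chaos: the closure in `L²(μ, F)` of the linear span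
of the random variables `H_α(ξ) y` with `|α| = k` and `y ∈ F`. -/
def chaos [MeasurableSpace B] (μ : Measure B) (e : ι → StrongDual ℝ B) (F : Type*)
    [NormedAddCommGroup F] [NormedSpace ℝ F] (k : ℕ) : Submodule ℝ (Lp F 2 μ) :=
  (Submodule.span ℝ {f : Lp F 2 μ | ∃ (α : ι →₀ ℕ) (y : F),
    α.degree = k ∧ f =ᵐ[μ] fun ξ => hermiteMulti e α ξ • y}).topologicalClosure

end Chaos

section Families

variable {B : Type*} [NormedAddCommGroup B] [MeasurableSpace B] {μ : Measure B}
  {W : Type*} {E : W → Type*} [∀ τ, NormedAddCommGroup (E τ)] [∀ τ, NormedSpace ℝ (E τ)]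

/-- The rescaled random variable `⨁ τ, ε ^ (K τ / 2) Ψ_τ`, where `Ψ_τ = ∑ k ≤ K τ, Ψ_{τ, k}`. -/
def rescaled (K : W → ℕ) (Ψ : ∀ τ, ℕ → Lp (E τ) 2 μ) (ε : ℝ) (ξ : B) : ∀ τ, E τ :=
  fun τ => ε ^ ((K τ : ℝ) / 2) • ∑ k ∈ Finset.range (K τ + 1), Ψ τ k ξ

variable [NormedSpace ℝ B] {H : Type*} [NormedAddCommGroup H] [InnerProductSpace ℝ H]

/-- The homogeneous part `h ↦ ⨁ τ, ∫ Ψ_{τ, K τ}(ξ + h) μ(dξ)`. -/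
def homPart (j : H →L[ℝ] B) (K : W → ℕ) (Ψ : ∀ τ, ℕ → Lp (E τ) 2 μ) (h : H) : ∀ τ, E τ :=
  fun τ => ∫ ξ, Ψ τ (K τ) (ξ + j h) ∂μ

/-- `I(s) = inf {|h|² / 2 : h ∈ H, Ψ_hom(h) = s}`, with `inf ∅ = +∞`. -/
def rateFunction (j : H →L[ℝ] B) (K : W → ℕ) (Ψ : ∀ τ, ℕ → Lp (E τ) 2 μ) (s : ∀ τ, E τ) :
    ℝ≥0∞ :=
  ⨅ (h : H) (_ : homPart j K Ψ h = s), ENNReal.ofReal (‖h‖ ^ 2 / 2)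

end Families

end WienerChaos

end

/-!
An element of the `k`-th chaos is an `L²` limit of Hermite polynomials of finitely many of the
standard normal coordinates `⟨ξ, e i⟩`. The Mehler formula makes each of them an eigenfunction of
a Gaussian averaging operator, and the Cameron-Martin density bounds that average by the median;
together with the Gaussian concentration inequality, obtained from the Prékopa-Leindler inequality
through property (τ), this gives the tail bound `μ(‖f‖ > 3 t ^ k ‖f‖_{L²}) ≤ C exp (-t ² / 4)`.

Since `ε ^ {k/2}` is exactly the factor which this bound turns into `exp (-M ² / (4 ε))`, replacing
a chaos element by a nearby polynomial in finitely many coordinates is negligible on the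
exponential scale. By homogeneity the rescaled polynomial is a continuous function of `ε` and of
the rescaled coordinates `√ε ⟨ξ, e i⟩`; at `ε = 0` the Hermite polynomials become monomials, whose
value at the coordinates of `h` is the integral over `ξ` of the polynomial shifted by `h`. So the
large deviation principle follows by contraction from the elementary one for finite-dimensional
Gaussian vectors; the infimum is attained, and the sublevel sets are compact, because the
homogeneous part is uniformly approximated by functions of finitely many coordinates on each
ball of `H`.
-/

noncomputable section

namespace WienerChaos

section PrekopaLeindler

lemma volume_preimage_midpoint (c : ℝ) (D : Set ℝ) :
    volume ((fun x : ℝ => (x + c) / 2) ⁻¹' D) = 2 * volume D := by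
  have hcomp : (fun x : ℝ => (x + c) / 2) ⁻¹' D
      = (fun x => x + c) ⁻¹' ((fun x => (2⁻¹ : ℝ) * x) ⁻¹' D) := by
    ext x; simp [div_eq_inv_mul]
  rw [hcomp, measure_preimage_add_right, Real.volume_preimage_mul_left (by norm_num)]
  norm_num

lemma volume_add_le_two_mul_volume_of_isCompact {A B D : Set ℝ} (hA : IsCompact A)
    (hB : IsCompact B) (hA₀ : A.Nonempty) (hB₀ : B.Nonempty)
    (hD : ∀ a ∈ A, ∀ b ∈ B, (a + b) / 2 ∈ D) :
    volume A + volume B ≤ 2 * volume D := by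
  obtain ⟨a₀, ha₀, hmax⟩ := hA.exists_isGreatest hA₀
  obtain ⟨b₀, hb₀, hmin⟩ := hB.exists_isLeast hB₀
  -- The sets `(A + b₀) / 2` and `(a₀ + B) / 2` lie in `D`, on the two sides of `m`.
  let m := (a₀ + b₀) / 2
  have left : volume A ≤ 2 * volume (D ∩ Set.Iic m) := by
    rw [← volume_preimage_midpoint b₀]
    exact measure_mono fun a ha => ⟨hD a ha b₀ hb₀, by
      simpa [m] using div_le_div_of_nonneg_right (add_le_add_left (hmax ha) b₀) zero_le_two⟩
  have right : volume B ≤ 2 * volume (D \ Set.Iic m) := by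
    rw [← volume_preimage_midpoint a₀, ← measure_sdiff_null (s := B) (t := {b₀}) (by simp)]
    refine measure_mono fun b hb => ⟨by simpa [add_comm] using hD a₀ ha₀ b hb.1, ?_⟩
    have hlt : b₀ < b := (hmin hb.1).lt_of_ne fun h => hb.2 (by simp [h])
    simp only [Set.mem_Iic, m, not_le]
    linarith
  calc volume A + volume B ≤ 2 * volume (D ∩ Set.Iic m) + 2 * volume (D \ Set.Iic m) :=
        add_le_add left right
    _ = 2 * volume D := by rw [← mul_add, measure_inter_add_sdiff _ measurableSet_Iic]

/-- The one-dimensional Brunn-Minkowski inequality. -/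
lemma volume_add_le_two_mul_volume {A B D : Set ℝ} (hA : MeasurableSet A) (hB : MeasurableSet B)
    (hA₀ : A.Nonempty) (hB₀ : B.Nonempty) (hD : ∀ a ∈ A, ∀ b ∈ B, (a + b) / 2 ∈ D) :
    volume A + volume B ≤ 2 * volume D := by
  obtain ⟨a, ha⟩ := hA₀
  obtain ⟨b, hb⟩ := hB₀
  have : Nonempty {K : Set ℝ // K ⊆ A ∧ IsCompact K} := ⟨∅, by simp⟩
  have : Nonempty {K : Set ℝ // K ⊆ B ∧ IsCompact K} := ⟨∅, by simp⟩
  rw [hA.measure_eq_iSup_isCompact, hB.measure_eq_iSup_isCompact]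
  simp_rw [iSup_and', iSup_subtype']
  refine ENNReal.iSup_add_iSup_le fun ⟨K, hKA, hK⟩ ⟨L, hLB, hL⟩ => ?_
  have hK' : insert a K ⊆ A := Set.insert_subset ha hKA
  have hL' : insert b L ⊆ B := Set.insert_subset hb hLB
  calc volume K + volume L ≤ volume (insert a K) + volume (insert b L) :=
        add_le_add (measure_mono (Set.subset_insert _ _)) (measure_mono (Set.subset_insert _ _))
    _ ≤ 2 * volume D :=
        volume_add_le_two_mul_volume_of_isCompact (hK.insert a) (hL.insert b)
          (Set.insert_nonempty _ _) (Set.insert_nonempty _ _)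
          fun x hx y hy => hD x (hK' hx) y (hL' hy)

lemma lintegral_min_one_eq_lintegral_meas_lt {α : Type*} [MeasurableSpace α] {μ : Measure α}
    {f : α → ℝ≥0∞} (hf : Measurable f) :
    ∫⁻ x, min (f x) 1 ∂μ = ∫⁻ t in Set.Ioo (0 : ℝ) 1, μ {x | ENNReal.ofReal t < f x} := by
  have hne : ∀ x, min (f x) 1 ≠ ⊤ := fun x => (min_le_right _ _).trans_lt ENNReal.one_lt_top |>.ne
  have hlevel : ∀ t ∈ Set.Ioi (0 : ℝ), μ {x | t < (min (f x) 1).toReal}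
      = (Set.Ioo (0 : ℝ) 1).indicator (fun t => μ {x | ENNReal.ofReal t < f x}) t := by
    intro t ht
    have hiff : ∀ x, t < (min (f x) 1).toReal ↔ ENNReal.ofReal t < f x ∧ t < 1 := fun x => by
      rw [← ENNReal.ofReal_lt_iff_lt_toReal (le_of_lt ht) (hne x), lt_min_iff,
        ENNReal.ofReal_lt_one]
    by_cases ht1 : t < 1
    · simp [hiff, ht1, Set.mem_Ioi.1 ht]
    · simp [hiff, ht1]
  calc ∫⁻ x, min (f x) 1 ∂μ = ∫⁻ x, ENNReal.ofReal (min (f x) 1).toReal ∂μ :=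
        lintegral_congr fun x => (ENNReal.ofReal_toReal (hne x)).symm
    _ = ∫⁻ t in Set.Ioi 0, μ {x | t < (min (f x) 1).toReal} :=
        lintegral_eq_lintegral_meas_lt _ (ae_of_all _ fun _ => ENNReal.toReal_nonneg)
          (hf.min measurable_const).ennreal_toReal.aemeasurable
    _ = _ := by
        rw [setLIntegral_congr_fun measurableSet_Ioi hlevel,
          setLIntegral_indicator measurableSet_Ioo,
          Set.inter_eq_left.2 Set.Ioo_subset_Ioi_self]

lemma mul_le_sq_of_add_le_two_mul {a b c : ℝ≥0∞} (h : a + b ≤ 2 * c) : a * b ≤ c ^ 2 := by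
  rcases eq_or_ne c ⊤ with rfl | hc
  · simp
  have hab : a + b ≠ ⊤ := ne_top_of_le_ne_top (ENNReal.mul_ne_top (by simp) hc) h
  lift c to ℝ≥0 using hc
  lift a to ℝ≥0 using (ENNReal.add_ne_top.1 hab).1
  lift b to ℝ≥0 using (ENNReal.add_ne_top.1 hab).2
  norm_cast at h ⊢
  rw [← NNReal.coe_le_coe] at h ⊢
  push_cast at h ⊢
  nlinarith [sq_nonneg ((a : ℝ) - b), a.coe_nonneg, b.coe_nonneg, c.coe_nonneg]

lemma lintegral_add_lintegral_le_of_iSup_eq_one {u v w : ℝ → ℝ≥0∞} (hu : Measurable u)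
    (hv : Measurable v) (hw : Measurable w) (hu₁ : ⨆ x, u x = 1) (hv₁ : ⨆ x, v x = 1)
    (h : ∀ x y, u x * v y ≤ w ((x + y) / 2) ^ 2) :
    (∫⁻ x, u x) + ∫⁻ x, v x ≤ 2 * ∫⁻ x, w x := by
  have layer : ∀ f : ℝ → ℝ≥0∞, Measurable f → ⨆ x, f x = 1 →
      ∫⁻ x, f x = ∫⁻ t in Set.Ioo (0 : ℝ) 1, volume {x | ENNReal.ofReal t < f x} :=
    fun f hf hf₁ => by
      rw [← lintegral_min_one_eq_lintegral_meas_lt hf]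
      exact lintegral_congr fun x => (min_eq_left (hf₁ ▸ le_iSup f x)).symm
  have superlevel_nonempty : ∀ f : ℝ → ℝ≥0∞, ⨆ x, f x = 1 → ∀ t ∈ Set.Ioo (0 : ℝ) 1,
      {x | ENNReal.ofReal t < f x}.Nonempty := fun f hf₁ t ht =>
    (lt_iSup_iff.1 (hf₁.symm ▸ ENNReal.ofReal_lt_one.2 ht.2 : ENNReal.ofReal t < ⨆ x, f x) :)
  have antitone_level : Antitone fun t : ℝ => volume {x | ENNReal.ofReal t < u x} :=
    fun s t hst => measure_mono fun x hx => (ENNReal.ofReal_le_ofReal hst).trans_lt hx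
  calc (∫⁻ x, u x) + ∫⁻ x, v x
      = ∫⁻ t in Set.Ioo (0 : ℝ) 1,
          (volume {x | ENNReal.ofReal t < u x} + volume {x | ENNReal.ofReal t < v x}) := by
        rw [layer u hu hu₁, layer v hv hv₁,
          lintegral_add_left' antitone_level.measurable.aemeasurable]
    _ ≤ ∫⁻ t in Set.Ioo (0 : ℝ) 1, 2 * volume {x | ENNReal.ofReal t < w x} := by
        refine setLIntegral_mono' measurableSet_Ioo fun t ht => ?_
        refine volume_add_le_two_mul_volume (measurableSet_lt measurable_const hu)
          (measurableSet_lt measurable_const hv) (superlevel_nonempty u hu₁ t ht)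
          (superlevel_nonempty v hv₁ t ht) fun a ha b hb => ?_
        refine lt_of_pow_lt_pow_left' 2 (lt_of_lt_of_le ?_ (h a b))
        rw [sq]
        exact ENNReal.mul_lt_mul ha hb
    _ = 2 * ∫⁻ x, min (w x) 1 := by
        rw [lintegral_const_mul' _ _ (by simp), lintegral_min_one_eq_lintegral_meas_lt hw]
    _ ≤ 2 * ∫⁻ x, w x := by
        gcongr
        exact min_le_left _ _

lemma lintegral_mul_lintegral_le_of_iSup_ne_top {u v w : ℝ → ℝ≥0∞} (hu : Measurable u)
    (hv : Measurable v) (hw : Measurable w) (hu_fin : ⨆ x, u x ≠ ⊤) (hv_fin : ⨆ x, v x ≠ ⊤)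
    (h : ∀ x y, u x * v y ≤ w ((x + y) / 2) ^ 2) :
    (∫⁻ x, u x) * (∫⁻ x, v x) ≤ (∫⁻ x, w x) ^ 2 := by
  set p := ⨆ x, u x
  set q := ⨆ x, v x
  rcases eq_or_ne p 0 with hp | hp
  · simp [ENNReal.iSup_eq_zero.1 hp]
  rcases eq_or_ne q 0 with hq | hq
  · simp [ENNReal.iSup_eq_zero.1 hq]
  have hpq : p * q ≠ ⊤ := ENNReal.mul_ne_top hu_fin hv_fin
  set c := (p * q) ^ (1 / 2 : ℝ)
  have hc : c ^ 2 = p * q := by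
    rw [← ENNReal.rpow_natCast, ← ENNReal.rpow_mul]; norm_num
  have hinv : c⁻¹ ^ 2 = p⁻¹ * q⁻¹ := by
    rw [← ENNReal.inv_pow, hc, ENNReal.mul_inv (.inl hp) (.inl hu_fin)]
  have normalized := mul_le_sq_of_add_le_two_mul <|
    lintegral_add_lintegral_le_of_iSup_eq_one (hu.const_mul p⁻¹) (hv.const_mul q⁻¹)
      (hw.const_mul c⁻¹)
      (by rw [← ENNReal.mul_iSup]; exact ENNReal.inv_mul_cancel hp hu_fin)
      (by rw [← ENNReal.mul_iSup]; exact ENNReal.inv_mul_cancel hq hv_fin)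
      (fun x y => by
        rw [mul_pow, hinv, mul_mul_mul_comm]
        gcongr
        exact h x y)
  rw [lintegral_const_mul _ hu, lintegral_const_mul _ hv, lintegral_const_mul _ hw, mul_pow, hinv,
    mul_mul_mul_comm, ← ENNReal.mul_inv (.inl hp) (.inl hu_fin)] at normalized
  exact (ENNReal.mul_le_mul_iff_right (ENNReal.inv_ne_zero.2 hpq)
    (ENNReal.inv_ne_top.2 (mul_ne_zero hp hq))).1 normalized

theorem prekopa_leindler {u v w : ℝ → ℝ≥0∞} (hu : Measurable u) (hv : Measurable v)
    (hw : Measurable w) (h : ∀ x y, u x * v y ≤ w ((x + y) / 2) ^ 2) :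
    (∫⁻ x, u x) * (∫⁻ x, v x) ≤ (∫⁻ x, w x) ^ 2 := by
  have truncate : ∀ f : ℝ → ℝ≥0∞, Measurable f →
      ∫⁻ x, f x = ⨆ n : ℕ, ∫⁻ x, min (f x) n := fun f hf => by
    rw [← lintegral_iSup (fun n => hf.min measurable_const)
      fun m n hmn x => min_le_min_left _ (by exact_mod_cast hmn)]
    refine lintegral_congr fun x => ?_
    have := inf_iSup_eq (f x) fun n : ℕ => (n : ℝ≥0∞)
    rwa [ENNReal.iSup_natCast, inf_top_eq] at this
  have iSup_min_ne_top : ∀ (f : ℝ → ℝ≥0∞) (n : ℕ), ⨆ x, min (f x) n ≠ ⊤ := fun f n =>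
    ne_top_of_le_ne_top (ENNReal.natCast_ne_top n) (iSup_le fun _ => min_le_right _ _)
  rw [truncate u hu, truncate v hv]
  simp_rw [ENNReal.iSup_mul, ENNReal.mul_iSup]
  exact iSup₂_le fun m n => lintegral_mul_lintegral_le_of_iSup_ne_top (hu.min measurable_const)
    (hv.min measurable_const) hw (iSup_min_ne_top u m) (iSup_min_ne_top v n) fun x y =>
      (mul_le_mul' (min_le_left _ _) (min_le_left _ _)).trans (h x y)

end PrekopaLeindler

section PropertyTau

variable {α β : Type*} [MeasurableSpace α] [MeasurableSpace β]

/-- Maurey's property `(τ)` of a measure with respect to a cost function, in its symmetric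
formulation: `(∫ u) (∫ v) ≤ 1` whenever `u x * v y ≤ exp (c x y)`. -/
def PropertyTau (μ : Measure α) (c : α → α → ℝ) : Prop :=
  ∀ ⦃u v : α → ℝ≥0∞⦄, Measurable u → Measurable v →
    (∀ x y, u x * v y ≤ ENNReal.ofReal (Real.exp (c x y))) →
      (∫⁻ x, u x ∂μ) * (∫⁻ x, v x ∂μ) ≤ 1

lemma PropertyTau.lintegral_mul_lintegral_le {μ : Measure α} {c : α → α → ℝ}
    (h : PropertyTau μ c) {u v : α → ℝ≥0∞} (hu : Measurable u) (hv : Measurable v) (a : ℝ)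
    (huv : ∀ x y, u x * v y ≤ ENNReal.ofReal (Real.exp (a + c x y))) :
    (∫⁻ x, u x ∂μ) * (∫⁻ x, v x ∂μ) ≤ ENNReal.ofReal (Real.exp a) := by
  have key := h hu (hv.const_mul (ENNReal.ofReal (Real.exp (-a)))) fun x y => by
    calc u x * (ENNReal.ofReal (Real.exp (-a)) * v y)
        = ENNReal.ofReal (Real.exp (-a)) * (u x * v y) := mul_left_comm _ _ _
      _ ≤ ENNReal.ofReal (Real.exp (-a)) * ENNReal.ofReal (Real.exp (a + c x y)) := by
          gcongr
          exact huv x y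
      _ = ENNReal.ofReal (Real.exp (c x y)) := by
          rw [← ENNReal.ofReal_mul (Real.exp_nonneg _), ← Real.exp_add, neg_add_cancel_left]
  rw [lintegral_const_mul _ hv, mul_left_comm, Real.exp_neg,
    ENNReal.ofReal_inv_of_pos (Real.exp_pos a)] at key
  simpa using (ENNReal.inv_mul_le_iff (by simp [Real.exp_pos]) (by simp)).1 key

lemma PropertyTau.map {μ : Measure α} {c : α → α → ℝ} {c' : β → β → ℝ} (h : PropertyTau μ c)
    {f : α → β} (hf : Measurable f) (hc : ∀ x y, c' (f x) (f y) ≤ c x y) :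
    PropertyTau (μ.map f) c' := by
  intro u v hu hv huv
  rw [lintegral_map hu hf, lintegral_map hv hf]
  refine h (hu.comp hf) (hv.comp hf) fun x y => (huv (f x) (f y)).trans ?_
  gcongr
  exact hc x y

lemma PropertyTau.prod {μ : Measure α} {ν : Measure β} [SFinite ν] {c : α → α → ℝ}
    {d : β → β → ℝ} (hμ : PropertyTau μ c) (hν : PropertyTau ν d) :
    PropertyTau (μ.prod ν) fun p q => c p.1 q.1 + d p.2 q.2 := by
  intro u v hu hv huv
  rw [lintegral_prod _ hu.aemeasurable, lintegral_prod _ hv.aemeasurable]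
  exact hμ hu.lintegral_prod_right' hv.lintegral_prod_right' fun x y =>
    hν.lintegral_mul_lintegral_le (hu.comp measurable_prodMk_left)
      (hv.comp measurable_prodMk_left) _ fun s t => huv (x, s) (y, t)

lemma PropertyTau.pi_fin {n : ℕ} {μ : Measure α} [SigmaFinite μ] {c : α → α → ℝ}
    (h : PropertyTau μ c) :
    PropertyTau (Measure.pi fun _ : Fin n => μ) fun x y => ∑ i, c (x i) (y i) := by
  induction n with
  | zero =>
    intro u v _ _ huv
    rw [Measure.pi_of_empty _ Fin.elim0, lintegral_dirac, lintegral_dirac]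
    simpa using huv Fin.elim0 Fin.elim0
  | succ n ih =>
    have cons := (measurePreserving_piFinSuccAbove (fun _ : Fin (n + 1) => μ) 0).symm
    rw [← cons.map_eq]
    exact (h.prod ih).map cons.measurable fun p q => by
      simp [MeasurableEquiv.piFinSuccAbove, Fin.insertNthEquiv, Fin.sum_univ_succ]

lemma PropertyTau.measure_mul_measure_le {μ : Measure α} {c : α → α → ℝ} (h : PropertyTau μ c)
    {A S : Set α} (hA : MeasurableSet A) (hS : MeasurableSet S) {q : ℝ}
    (hq : ∀ x ∈ S, ∀ y ∈ A, q ≤ c x y) : μ S * μ A ≤ ENNReal.ofReal (Real.exp (-q)) := by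
  rw [← lintegral_indicator_one hS, ← lintegral_indicator_one hA]
  refine h.lintegral_mul_lintegral_le (measurable_one.indicator hS) (measurable_one.indicator hA)
    _ fun x y => ?_
  by_cases hx : x ∈ S
  · by_cases hy : y ∈ A
    · simpa [hx, hy] using hq x hx y hy
    · simp [hy]
  · simp [hx]

lemma propertyTau_gaussianReal : PropertyTau (gaussianReal 0 1) fun x y => (x - y) ^ 2 / 4 := by
  intro u v hu hv huv
  have hpdf : Measurable (gaussianPDF 0 1) := measurable_gaussianPDF 0 1
  have pdf_midpoint : ∀ x y, gaussianPDF 0 1 x * gaussianPDF 0 1 y *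
      ENNReal.ofReal (Real.exp ((x - y) ^ 2 / 4)) = gaussianPDF 0 1 ((x + y) / 2) ^ 2 := by
    intro x y
    simp only [gaussianPDF]
    rw [← ENNReal.ofReal_mul (gaussianPDFReal_nonneg _ _ _),
      ← ENNReal.ofReal_mul (mul_nonneg (gaussianPDFReal_nonneg _ _ _)
        (gaussianPDFReal_nonneg _ _ _)), ← ENNReal.ofReal_pow (gaussianPDFReal_nonneg _ _ _)]
    congr 1
    simp only [gaussianPDFReal_def, NNReal.coe_one, mul_one, sub_zero]
    rw [mul_pow, mul_mul_mul_comm, mul_assoc, ← Real.exp_add, ← Real.exp_add,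
      ← Real.exp_nat_mul, sq (√(2 * Real.pi))⁻¹]
    congr 2
    push_cast
    ring
  have key := prekopa_leindler (hpdf.mul hu) (hpdf.mul hv) hpdf fun x y => by
    calc (gaussianPDF 0 1 * u) x * (gaussianPDF 0 1 * v) y
        = gaussianPDF 0 1 x * gaussianPDF 0 1 y * (u x * v y) := mul_mul_mul_comm _ _ _ _
      _ ≤ gaussianPDF 0 1 x * gaussianPDF 0 1 y *
          ENNReal.ofReal (Real.exp ((x - y) ^ 2 / 4)) := by gcongr; exact huv x y
      _ = gaussianPDF 0 1 ((x + y) / 2) ^ 2 := pdf_midpoint x y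
  rw [lintegral_gaussianPDF_eq_one 0 one_ne_zero, one_pow] at key
  rwa [gaussianReal_of_var_ne_zero 0 one_ne_zero,
    lintegral_withDensity_eq_lintegral_mul _ hpdf hu,
    lintegral_withDensity_eq_lintegral_mul _ hpdf hv]

variable {E : Type*} [NormedAddCommGroup E] [InnerProductSpace ℝ E] [FiniteDimensional ℝ E]
  [MeasurableSpace E] [BorelSpace E]

lemma propertyTau_stdGaussian : PropertyTau (stdGaussian E) fun x y => ‖x - y‖ ^ 2 / 4 := by
  refine propertyTau_gaussianReal.pi_fin.map (by fun_prop) fun x y => le_of_eq ?_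
  rw [← Finset.sum_div, ← Finset.sum_sub_distrib]
  simp_rw [← sub_smul]
  rw [← (stdOrthonormalBasis ℝ E).sum_sq_norm_inner_right]
  simp [(stdOrthonormalBasis ℝ E).orthonormal.inner_right_fintype]

end PropertyTau

section CameronMartin

lemma covariance_eq_zero_of_variance_eq_zero {Ω : Type*} [MeasurableSpace Ω] {μ : Measure Ω}
    [IsProbabilityMeasure μ] {X Y : Ω → ℝ} (hY : MemLp Y 2 μ) (h : Var[Y; μ] = 0) :
    cov[X, Y; μ] = 0 := by
  have hY_const := ae_eq_integral_of_variance_eq_zero hY h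
  refine integral_eq_zero_of_ae ?_
  filter_upwards [hY_const] with ω hω
  simp [hω]

variable {B : Type*} [NormedAddCommGroup B] [NormedSpace ℝ B] [MeasurableSpace B]
  {μ : Measure B} [IsGaussian μ]

lemma map_dual_eq_gaussianReal (hμ : ∀ ℓ : StrongDual ℝ B, ∫ ξ, ℓ ξ ∂μ = 0)
    (ℓ : StrongDual ℝ B) : μ.map ℓ = gaussianReal 0 Var[ℓ; μ].toNNReal := by
  rw [IsGaussian.map_eq_gaussianReal, hμ]

lemma integral_cexp_mul_dual (hμ : ∀ ℓ : StrongDual ℝ B, ∫ ξ, ℓ ξ ∂μ = 0) (ℓ : StrongDual ℝ B)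
    (z : ℂ) : ∫ ξ, Complex.exp (z * ℓ ξ) ∂μ = Complex.exp (Var[ℓ; μ] * z ^ 2 / 2) := by
  have := complexMGF_gaussianReal (map_dual_eq_gaussianReal hμ ℓ) z
  rwa [complexMGF, Real.coe_toNNReal _ (variance_nonneg _ _), Complex.ofReal_zero, mul_zero,
    zero_add] at this

lemma integral_exp_mul_dual (hμ : ∀ ℓ : StrongDual ℝ B, ∫ ξ, ℓ ξ ∂μ = 0) (ℓ : StrongDual ℝ B)
    (t : ℝ) : ∫ ξ, Real.exp (t * ℓ ξ) ∂μ = Real.exp (Var[ℓ; μ] * t ^ 2 / 2) := by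
  have := mgf_gaussianReal (map_dual_eq_gaussianReal hμ ℓ) t
  rwa [mgf, Real.coe_toNNReal _ (variance_nonneg _ _), zero_mul, zero_add] at this

variable [BorelSpace B]

lemma integrable_exp_mul_dual (ℓ : StrongDual ℝ B) (t : ℝ) :
    Integrable (fun ξ => Real.exp (t * ℓ ξ)) μ := by
  have : Integrable (fun x => Real.exp (t * x)) (μ.map ℓ) := by
    rw [IsGaussian.map_eq_gaussianReal]
    exact integrable_exp_mul_gaussianReal t
  exact this.comp_measurable (by fun_prop)

lemma integral_cexp_dual_mul_I_add_dual (hμ : ∀ ℓ : StrongDual ℝ B, ∫ ξ, ℓ ξ ∂μ = 0)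
    (L ℓ : StrongDual ℝ B) :
    ∫ ξ, Complex.exp (L ξ * Complex.I + ℓ ξ) ∂μ
      = Complex.exp (-Var[L; μ] / 2 + Var[ℓ; μ] / 2 + cov[L, ℓ; μ] * Complex.I) := by
  have hL₂ := IsGaussian.memLp_dual μ L 2 (by simp)
  have hℓ₂ := IsGaussian.memLp_dual μ ℓ 2 (by simp)
  -- `M` is the part of `L` that is independent of `ℓ`.
  obtain ⟨a, ha⟩ : ∃ a : ℝ, cov[L, ℓ; μ] = a * Var[ℓ; μ] := by
    rcases eq_or_ne Var[ℓ; μ] 0 with h | h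
    · exact ⟨0, by rw [covariance_eq_zero_of_variance_eq_zero hℓ₂ h, zero_mul]⟩
    · exact ⟨cov[L, ℓ; μ] / Var[ℓ; μ], (div_mul_cancel₀ _ h).symm⟩
  let M := L - a • ℓ
  have hM : (M : B → ℝ) = L - a • ⇑ℓ := rfl
  have cov_M : cov[M, ℓ; μ] = 0 := by
    rw [hM, covariance_sub_left hL₂ (hℓ₂.const_smul a) hℓ₂, covariance_smul_left,
      covariance_self ℓ.continuous.aemeasurable, ha, sub_self]
  have var_M : Var[M; μ] = Var[L; μ] - a ^ 2 * Var[ℓ; μ] := by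
    rw [hM, variance_sub hL₂ (hℓ₂.const_smul a), covariance_smul_right, variance_smul, ha]
    ring
  have indep : IndepFun M ℓ μ := HasGaussianLaw.indepFun_of_covariance_eq_zero
    ((IsGaussian.hasGaussianLaw_id (μ := μ)).map_fun (M.prod ℓ)) cov_M
  have factor : ∀ ξ, Complex.exp (L ξ * Complex.I + ℓ ξ)
      = Complex.exp (Complex.I * M ξ) * Complex.exp ((1 + a * Complex.I) * ℓ ξ) := fun ξ => by
    rw [← Complex.exp_add]
    congr 1
    simp only [sub_apply, smul_apply, smul_eq_mul, Complex.ofReal_sub, Complex.ofReal_mul, M]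
    ring
  simp_rw [factor]
  rw [indep.integral_fun_comp_mul_comp (f := fun x : ℝ => Complex.exp (Complex.I * x))
    (g := fun x : ℝ => Complex.exp ((1 + a * Complex.I) * x)) (by fun_prop) (by fun_prop)
    (by fun_prop) (by fun_prop), integral_cexp_mul_dual hμ, integral_cexp_mul_dual hμ,
    ← Complex.exp_add, var_M, ha]
  congr 1
  push_cast
  linear_combination ((Var[L; μ] : ℂ) / 2) * Complex.I_sq

variable [CompleteSpace B] [SecondCountableTopology B]

/-- The Cameron-Martin formula. -/
theorem map_add_const_eq_withDensity (hμ : ∀ ℓ : StrongDual ℝ B, ∫ ξ, ℓ ξ ∂μ = 0)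
    {ℓ : StrongDual ℝ B} {v : B} (hv : ∀ L : StrongDual ℝ B, cov[L, ℓ; μ] = L v) :
    μ.map (fun ξ => ξ + v)
      = μ.withDensity fun ξ => ENNReal.ofReal (Real.exp (ℓ ξ - ℓ v / 2)) := by
  have var_ℓ : Var[ℓ; μ] = ℓ v := by rw [← covariance_self ℓ.continuous.aemeasurable, hv]
  have density_integrable : Integrable (fun ξ => Real.exp (ℓ ξ - ℓ v / 2)) μ := by
    simpa [sub_eq_add_neg, Real.exp_add] using
      (integrable_exp_mul_dual ℓ 1).mul_const (Real.exp (-(ℓ v / 2)))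
  have : IsFiniteMeasure (μ.withDensity fun ξ => ENNReal.ofReal (Real.exp (ℓ ξ - ℓ v / 2))) :=
    isFiniteMeasure_withDensity density_integrable.lintegral_lt_top.ne
  refine Measure.ext_of_charFunDual (funext fun L => ?_)
  have tilt : ∀ ξ, (ENNReal.ofReal (Real.exp (ℓ ξ - ℓ v / 2))).toReal •
      Complex.exp (L ξ * Complex.I)
        = Complex.exp (-(ℓ v / 2)) * Complex.exp (L ξ * Complex.I + ℓ ξ) := fun ξ => by
    rw [ENNReal.toReal_ofReal (Real.exp_nonneg _), Complex.real_smul, Complex.ofReal_exp,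
      ← Complex.exp_add, ← Complex.exp_add]
    congr 1
    push_cast
    ring
  rw [charFunDual_map_add_const, IsGaussian.charFunDual_eq_of_forall_strongDual_eq_zero hμ,
    charFunDual_apply, integral_withDensity_eq_integral_toReal_smul (by fun_prop) (by simp)]
  simp_rw [tilt]
  rw [integral_const_mul, integral_cexp_dual_mul_I_add_dual hμ, hv, var_ℓ, ← Complex.exp_add,
    ← Complex.exp_add]
  congr 1
  ring

lemma lintegral_add_const_le (hμ : ∀ ℓ : StrongDual ℝ B, ∫ ξ, ℓ ξ ∂μ = 0)
    {ℓ : StrongDual ℝ B} {v : B} (hv : ∀ L : StrongDual ℝ B, cov[L, ℓ; μ] = L v)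
    {f : B → ℝ≥0∞} (hf : Measurable f) :
    ∫⁻ ξ, f (ξ + v) ∂μ
      ≤ ENNReal.ofReal (Real.exp (ℓ v / 2)) * (∫⁻ ξ, f ξ ^ 2 ∂μ) ^ (1 / 2 : ℝ) := by
  let D : B → ℝ≥0∞ := fun ξ => ENNReal.ofReal (Real.exp (ℓ ξ - ℓ v / 2))
  have hD : Measurable D := by fun_prop
  have var_ℓ : Var[ℓ; μ] = ℓ v := by rw [← covariance_self ℓ.continuous.aemeasurable, hv]
  have D_sq : ∫⁻ ξ, D ξ ^ (2 : ℝ) ∂μ = ENNReal.ofReal (Real.exp (ℓ v)) := by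
    have hexp : ∀ ξ, D ξ ^ (2 : ℝ)
        = ENNReal.ofReal (Real.exp (-(ℓ v)) * Real.exp (2 * ℓ ξ)) := fun ξ => by
      rw [ENNReal.ofReal_rpow_of_pos (Real.exp_pos _), ← Real.exp_mul, ← Real.exp_add]
      ring_nf
    simp_rw [hexp]
    rw [← ofReal_integral_eq_lintegral_ofReal ((integrable_exp_mul_dual ℓ 2).const_mul _)
      (ae_of_all _ fun ξ => by positivity), integral_const_mul, integral_exp_mul_dual hμ, var_ℓ,
      ← Real.exp_add]
    ring_nf
  calc ∫⁻ ξ, f (ξ + v) ∂μ = ∫⁻ ξ, (D * f) ξ ∂μ := by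
        rw [← lintegral_withDensity_eq_lintegral_mul _ hD hf,
          ← map_add_const_eq_withDensity hμ hv, lintegral_map hf (by fun_prop)]
    _ ≤ (∫⁻ ξ, D ξ ^ (2 : ℝ) ∂μ) ^ (1 / 2 : ℝ) * (∫⁻ ξ, f ξ ^ (2 : ℝ) ∂μ) ^ (1 / 2 : ℝ) :=
        ENNReal.lintegral_mul_le_Lp_mul_Lq μ Real.HolderConjugate.two_two hD.aemeasurable
          hf.aemeasurable
    _ = _ := by
        rw [D_sq, ENNReal.ofReal_rpow_of_pos (Real.exp_pos _), ← Real.exp_mul]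
        simp only [ENNReal.rpow_two, mul_one_div]

lemma map_neg_eq_self (hμ : ∀ ℓ : StrongDual ℝ B, ∫ ξ, ℓ ξ ∂μ = 0) : μ.map (fun ξ => -ξ) = μ := by
  have : IsGaussian (μ.map fun ξ => -ξ) :=
    inferInstanceAs (IsGaussian (μ.map (-ContinuousLinearMap.id ℝ B)))
  refine Measure.ext_of_charFunDual (funext fun L => ?_)
  have neg_L : charFunDual (μ.map fun ξ => -ξ) L = charFunDual μ (-L) := by
    rw [charFunDual_apply, charFunDual_apply, integral_map (by fun_prop) (by fun_prop)]
    simp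
  have var_neg : Var[⇑(-L); μ] = Var[L; μ] := variance_neg
  rw [neg_L, IsGaussian.charFunDual_eq_of_forall_strongDual_eq_zero hμ,
    IsGaussian.charFunDual_eq_of_forall_strongDual_eq_zero hμ, var_neg]

-- Symmetrising the Cameron-Martin density `exp (ℓ ξ - ℓ v / 2)` over `A` gives
-- `cosh (ℓ ξ) * exp (-ℓ v / 2)`.
lemma exp_mul_measure_le_measure_add_const (hμ : ∀ ℓ : StrongDual ℝ B, ∫ ξ, ℓ ξ ∂μ = 0)
    {ℓ : StrongDual ℝ B} {v : B} (hv : ∀ L : StrongDual ℝ B, cov[L, ℓ; μ] = L v)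
    {A : Set B} (hA : MeasurableSet A) (hA_symm : ∀ ξ, -ξ ∈ A ↔ ξ ∈ A) :
    ENNReal.ofReal (Real.exp (-(ℓ v / 2))) * μ A ≤ μ {ξ | ξ + v ∈ A} := by
  set c := ENNReal.ofReal (Real.exp (-(ℓ v / 2)))
  have shift : μ {ξ | ξ + v ∈ A} = ∫⁻ ξ in A, c * ENNReal.ofReal (Real.exp (ℓ ξ)) ∂μ := by
    have := congrArg (· A) (map_add_const_eq_withDensity hμ hv)
    simp only [Measure.map_apply (measurable_add_const v) hA, withDensity_apply _ hA] at this
    rw [← Set.preimage_ofPred_eq, Set.ofPred_mem_eq, this]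
    refine lintegral_congr fun ξ => ?_
    rw [← ENNReal.ofReal_mul (Real.exp_nonneg _), ← Real.exp_add, neg_add_eq_sub]
  have reflect : ∫⁻ ξ in A, c * ENNReal.ofReal (Real.exp (ℓ ξ)) ∂μ
      = ∫⁻ ξ in A, c * ENNReal.ofReal (Real.exp (-(ℓ ξ))) ∂μ := by
    conv_lhs => rw [← map_neg_eq_self hμ]
    rw [setLIntegral_map hA (by fun_prop) (by fun_prop)]
    simp [Set.preimage, hA_symm]
  have cosh_ge : ∀ ξ, 2 * c
      ≤ c * ENNReal.ofReal (Real.exp (ℓ ξ)) + c * ENNReal.ofReal (Real.exp (-(ℓ ξ))) := fun ξ => by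
    rw [← mul_add, mul_comm 2, ← ENNReal.ofReal_add (by positivity) (by positivity),
      ← ENNReal.ofReal_ofNat 2]
    gcongr
    linarith [Real.one_le_cosh (ℓ ξ), Real.cosh_eq (ℓ ξ)]
  refine (ENNReal.mul_le_mul_iff_right two_ne_zero ENNReal.ofNat_ne_top).1 ?_
  calc 2 * (c * μ A) = ∫⁻ _ in A, 2 * c ∂μ := by rw [setLIntegral_const, mul_assoc]
    _ ≤ ∫⁻ ξ in A, c * ENNReal.ofReal (Real.exp (ℓ ξ))
          + c * ENNReal.ofReal (Real.exp (-(ℓ ξ))) ∂μ := lintegral_mono cosh_ge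
    _ = 2 * μ {ξ | ξ + v ∈ A} := by
        rw [lintegral_add_left (by fun_prop), ← reflect, ← shift, two_mul]

lemma lintegral_lintegral_rotation (hμ : ∀ ℓ : StrongDual ℝ B, ∫ ξ, ℓ ξ ∂μ = 0) {ρ σ : ℝ}
    (hρσ : ρ ^ 2 + σ ^ 2 = 1) {f : B → ℝ≥0∞} (hf : Measurable f) :
    ∫⁻ x, ∫⁻ z, f (ρ • x + σ • z) ∂μ ∂μ = ∫⁻ x, f x ∂μ := by
  obtain ⟨θ, rfl, rfl⟩ : ∃ θ : ℝ, Real.cos θ = ρ ∧ Real.sin θ = σ := by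
    obtain ⟨θ, hθ⟩ := (Complex.norm_eq_one_iff ⟨ρ, σ⟩).1 <| by
      rw [Complex.norm_def, Complex.normSq_mk, ← sq, ← sq, hρσ, Real.sqrt_one]
    exact ⟨θ, by simpa using congrArg Complex.re hθ, by simpa using congrArg Complex.im hθ⟩
  calc ∫⁻ x, ∫⁻ z, f (Real.cos θ • x + Real.sin θ • z) ∂μ ∂μ
      = ∫⁻ p, f p.1 ∂(μ.prod μ).map (ContinuousLinearMap.rotation θ) := by
        rw [lintegral_map (by fun_prop) (by fun_prop), lintegral_prod _ (by fun_prop)]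
        simp only [ContinuousLinearMap.rotation_apply]
    _ = ∫⁻ x, f x ∂μ := by
        rw [IsGaussian.map_rotation_eq_self_of_forall_strongDual_eq_zero hμ,
          lintegral_prod _ (by fun_prop)]
        simp

variable {E : Type*} [NormedAddCommGroup E] [InnerProductSpace ℝ E] [FiniteDimensional ℝ E]
  [MeasurableSpace E] [BorelSpace E]

lemma covariance_innerSL_stdGaussian (L : StrongDual ℝ E) (h : E) :
    cov[L, innerSL ℝ h; stdGaussian E] = L h := by
  have cov_eq_inner := covarianceBilin_apply_eq_cov (μ := stdGaussian E) IsGaussian.memLp_two_id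
    ((InnerProductSpace.toDual ℝ E).symm L) h
  rw [covarianceBilin_stdGaussian, innerSL_apply_apply,
    InnerProductSpace.toDual_symm_apply] at cov_eq_inner
  simpa using cov_eq_inner.symm

end CameronMartin

section Hermite

open Polynomial

lemma derivative_hermite_succ (n : ℕ) :
    derivative (hermite (n + 1)) = (n + 1 : ℤ[X]) * hermite n := by
  induction n with
  | zero => simp
  | succ n ih =>
    have derivative_cast : derivative ((n : ℤ[X]) + 1) = 0 := by simp
    rw [hermite_succ (n + 1), derivative_sub, derivative_mul, derivative_X, ih, derivative_mul,
      one_mul, hermite_succ n, derivative_cast]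
    push_cast
    ring

lemma integrable_pow_gaussianReal (m : ℝ) (v : ℝ≥0) (n : ℕ) :
    Integrable (fun x : ℝ => x ^ n) (gaussianReal m v) :=
  (memLp_id_gaussianReal (n : ℝ≥0)).integrable_norm_pow'.mono (by fun_prop)
    (ae_of_all _ fun x => by simp)

lemma integrable_eval_gaussianReal (m : ℝ) (v : ℝ≥0) (p : ℝ[X]) :
    Integrable (fun x => p.eval x) (gaussianReal m v) := by
  simp_rw [eval_eq_sum_range]
  exact integrable_finsetSum _ fun i _ => (integrable_pow_gaussianReal m v i).const_mul _

lemma hasDerivAt_gaussianPDFReal {v : ℝ≥0} (hv : v ≠ 0) (m x : ℝ) :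
    HasDerivAt (gaussianPDFReal m v) (-(x - m) / v * gaussianPDFReal m v x) x := by
  have hv' : (v : ℝ) ≠ 0 := by exact_mod_cast hv
  have hasDerivAt_exponent : HasDerivAt (fun x => -(x - m) ^ 2 / (2 * v)) (-(x - m) / v) x := by
    convert! (((hasDerivAt_id x).sub_const m).fun_pow 2).fun_neg.div_const (2 * (v : ℝ)) using 1
    simp only [neg_sub, Nat.cast_ofNat, id_eq, Nat.add_one_sub_one, pow_one, mul_one]
    field_simp
    ring
  convert! hasDerivAt_exponent.exp.const_mul (√(2 * Real.pi * v))⁻¹ using 1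
  rw [gaussianPDFReal_def]
  ring

lemma integral_mul_eval_gaussianReal (v : ℝ≥0) (p : ℝ[X]) :
    ∫ x, x * p.eval x ∂gaussianReal 0 v = v * ∫ x, p.derivative.eval x ∂gaussianReal 0 v := by
  rcases eq_or_ne v 0 with rfl | hv
  · simp
  have hv' : (v : ℝ) ≠ 0 := by exact_mod_cast hv
  have integrable_mul_pdf (q : ℝ[X]) :
      Integrable (fun x => q.eval x * gaussianPDFReal 0 v x) volume := by
    have := integrable_eval_gaussianReal 0 v q
    rw [gaussianReal_of_var_ne_zero 0 hv,
      integrable_withDensity_iff (measurable_gaussianPDF 0 v) (ae_of_all _ fun x =>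
        gaussianPDF_lt_top)] at this
    simpa [toReal_gaussianPDF] using this
  have parts := integral_mul_deriv_eq_deriv_mul_of_integrable (u := fun x => p.eval x)
    (fun x _ => p.hasDerivAt x) (fun x _ => hasDerivAt_gaussianPDFReal hv 0 x)
    ((integrable_mul_pdf (C (-(v : ℝ)⁻¹) * X * p)).congr
      (ae_of_all _ fun x => by
        simp only [map_neg, neg_mul, eval_neg, eval_mul, eval_C, eval_X, sub_zero, Pi.mul_apply]
        ring))
    (integrable_mul_pdf p.derivative) (integrable_mul_pdf p)
  simp only [integral_gaussianReal_eq_integral_smul hv, smul_eq_mul]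
  calc ∫ x, gaussianPDFReal 0 v x * (x * p.eval x)
      = -v * ∫ x, p.eval x * (-(x - 0) / v * gaussianPDFReal 0 v x) := by
        rw [← integral_const_mul]
        congr 1 with x
        field_simp
        ring
    _ = v * ∫ x, gaussianPDFReal 0 v x * p.derivative.eval x := by
        simp only [parts, neg_mul_neg, mul_comm]

/-- The monic Hermite polynomials of variance `v`, orthogonal for the centred normal law of
variance `v` when `v ≥ 0`. They interpolate between the monomials, `v = 0`, and the usual Hermite
polynomials, `v = 1`. -/
def hermiteOfVariance (v : ℝ) : ℕ → ℝ[X]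
  | 0 => 1
  | 1 => X
  | k + 2 => X * hermiteOfVariance v (k + 1) - C ((k + 1) * v) * hermiteOfVariance v k

@[simp]
lemma hermiteOfVariance_zero_right (v : ℝ) : hermiteOfVariance v 0 = 1 := rfl

@[simp]
lemma hermiteOfVariance_one_right (v : ℝ) : hermiteOfVariance v 1 = X := rfl

lemma hermiteOfVariance_add_two (v : ℝ) (k : ℕ) : hermiteOfVariance v (k + 2)
    = X * hermiteOfVariance v (k + 1) - C ((k + 1) * v) * hermiteOfVariance v k := rfl

lemma hermiteOfVariance_one (k : ℕ) :
    hermiteOfVariance 1 k = (hermite k).map (algebraMap ℤ ℝ) := by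
  induction k using Nat.twoStepInduction with
  | zero => simp
  | one => simp
  | more k ih ih_succ =>
    rw [hermiteOfVariance_add_two, ih, ih_succ, hermite_succ (k + 1), derivative_hermite_succ]
    simp

lemma derivative_hermiteOfVariance_succ (v : ℝ) (k : ℕ) :
    derivative (hermiteOfVariance v (k + 1)) = C (k + 1 : ℝ) * hermiteOfVariance v k := by
  induction k using Nat.twoStepInduction with
  | zero => simp
  | one =>
    rw [hermiteOfVariance_add_two]
    simp only [zero_add, hermiteOfVariance_one_right, CharP.cast_eq_zero, one_mul,
      hermiteOfVariance_zero_right, mul_one, derivative_sub, derivative_mul, derivative_X,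
      derivative_C, sub_zero, Nat.cast_one, map_add, map_one]
    ring
  | more k ih ih_succ =>
    rw [hermiteOfVariance_add_two v (k + 1), derivative_sub, derivative_mul, derivative_X,
      derivative_C_mul, ih, ih_succ, hermiteOfVariance_add_two v k]
    push_cast
    simp only [map_add, map_mul, map_one, map_ofNat]
    ring

lemma eval_hermiteOfVariance_sq_mul (t v x : ℝ) (k : ℕ) :
    (hermiteOfVariance (t ^ 2 * v) k).eval (t * x) = t ^ k * (hermiteOfVariance v k).eval x := by
  induction k using Nat.twoStepInduction with
  | zero => simp
  | one => simp
  | more k ih ih_succ =>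
    simp only [hermiteOfVariance_add_two, eval_sub, eval_mul, eval_X, eval_C, ih, ih_succ]
    ring

@[fun_prop]
lemma continuous_eval_hermiteOfVariance {T : Type*} [TopologicalSpace T] {v x : T → ℝ}
    (hv : Continuous v) (hx : Continuous x) (k : ℕ) :
    Continuous fun t => (hermiteOfVariance (v t) k).eval (x t) := by
  induction k using Nat.twoStepInduction with
  | zero => simpa using continuous_const
  | one => simpa using hx
  | more k ih ih_succ =>
    simp only [hermiteOfVariance_add_two, eval_sub, eval_mul, eval_X, eval_C]
    fun_prop

lemma integrable_eval_add_mul_gaussianReal (p : ℝ[X]) (x σ m : ℝ) (v : ℝ≥0) :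
    Integrable (fun z => p.eval (x + σ * z)) (gaussianReal m v) := by
  have := integrable_eval_gaussianReal m v (p.comp (C x + C σ * X))
  simpa using this

lemma integral_eval_hermiteOfVariance_add_mul (v x σ : ℝ) (k : ℕ) :
    ∫ z, (hermiteOfVariance v k).eval (x + σ * z) ∂gaussianReal 0 1
      = (hermiteOfVariance (v - σ ^ 2) k).eval x := by
  induction k using Nat.twoStepInduction with
  | zero => simp
  | one =>
    have integral_id : ∫ z : ℝ, z ∂gaussianReal 0 1 = 0 := integral_id_gaussianReal
    have integrable_id : Integrable (fun z : ℝ => z) (gaussianReal 0 1) := by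
      simpa using integrable_pow_gaussianReal 0 1 1
    simp only [hermiteOfVariance_one_right, eval_X]
    rw [integral_add (integrable_const _) (integrable_id.const_mul σ), integral_const_mul,
      integral_id]
    simp
  | more k ih ih_succ =>
    set h := fun j z => (hermiteOfVariance v j).eval (x + σ * z) with h_def
    have integrable_h (j : ℕ) : Integrable (h j) (gaussianReal 0 1) :=
      integrable_eval_add_mul_gaussianReal _ x σ 0 1
    have integral_id_mul : ∫ z, z * h (k + 1) z ∂gaussianReal 0 1
        = σ * (k + 1) * ∫ z, h k z ∂gaussianReal 0 1 := by
      have parts := integral_mul_eval_gaussianReal 1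
        ((hermiteOfVariance v (k + 1)).comp (C x + C σ * X))
      simpa [derivative_comp, derivative_hermiteOfVariance_succ, integral_const_mul, h_def,
        mul_assoc] using parts
    have integrable_id_mul : Integrable (fun z => z * h (k + 1) z) (gaussianReal 0 1) := by
      have := integrable_eval_gaussianReal 0 1
        (X * (hermiteOfVariance v (k + 1)).comp (C x + C σ * X))
      simpa using this
    calc ∫ z, h (k + 2) z ∂gaussianReal 0 1
        = ∫ z, (x * h (k + 1) z + σ * (z * h (k + 1) z)) - (k + 1) * v * h k z
            ∂gaussianReal 0 1 := by
          congr 1 with z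
          simp only [h_def, hermiteOfVariance_add_two, eval_sub, eval_mul, eval_X, eval_C]
          ring
      _ = x * ∫ z, h (k + 1) z ∂gaussianReal 0 1
            - (k + 1) * (v - σ ^ 2) * ∫ z, h k z ∂gaussianReal 0 1 := by
          rw [integral_sub (by fun_prop) (by fun_prop), integral_add (by fun_prop) (by fun_prop)]
          simp only [integral_const_mul, integral_id_mul]
          ring
      _ = (hermiteOfVariance (v - σ ^ 2) (k + 2)).eval x := by
          rw [ih, ih_succ, hermiteOfVariance_add_two]
          simp

end Hermite

section HermiteComb

variable {κ : Type*} [Fintype κ]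

/-- The product of the normalised Hermite polynomials of variance `v` and degrees `α i`. -/
def hermiteProd (v : ℝ) (α : κ → ℕ) (z : EuclideanSpace ℝ κ) : ℝ :=
  ∏ i, (hermiteOfVariance v (α i)).eval (z i) / √((α i).factorial : ℝ)

@[fun_prop]
lemma continuous_hermiteProd {T : Type*} [TopologicalSpace T] {v : T → ℝ}
    {z : T → EuclideanSpace ℝ κ} (hv : Continuous v) (hz : Continuous z) (α : κ → ℕ) :
    Continuous fun t => hermiteProd (v t) α (z t) := by
  unfold hermiteProd
  fun_prop

lemma hermiteProd_sq_mul (t v : ℝ) (α : κ → ℕ) (z : EuclideanSpace ℝ κ) :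
    hermiteProd (t ^ 2 * v) α (t • z) = t ^ (∑ i, α i) * hermiteProd v α z := by
  simp only [hermiteProd, PiLp.smul_apply, smul_eq_mul, eval_hermiteOfVariance_sq_mul,
    mul_div_assoc, Finset.prod_mul_distrib, Finset.prod_pow_eq_pow_sum]

lemma integrable_hermiteProd_add_smul (v : ℝ) (α : κ → ℕ) (x : EuclideanSpace ℝ κ) (σ : ℝ) :
    Integrable (fun z => hermiteProd v α (x + σ • z)) (stdGaussian (EuclideanSpace ℝ κ)) := by
  rw [← map_pi_eq_stdGaussian, integrable_map_measure (by fun_prop) (by fun_prop)]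
  exact Integrable.fintype_prod
    (f := fun i t => (hermiteOfVariance v (α i)).eval (x i + σ * t) / √((α i).factorial : ℝ))
    fun i => (integrable_eval_add_mul_gaussianReal _ _ _ _ _).div_const _

lemma integral_hermiteProd_add_smul (v : ℝ) (α : κ → ℕ) (x : EuclideanSpace ℝ κ) (σ : ℝ) :
    ∫ z, hermiteProd v α (x + σ • z) ∂stdGaussian (EuclideanSpace ℝ κ)
      = hermiteProd (v - σ ^ 2) α x := by
  have integral_pi := integral_fintype_prod_eq_prod (𝕜 := ℝ) (μ := fun _ : κ => gaussianReal 0 1)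
    fun i t => (hermiteOfVariance v (α i)).eval (x i + σ * t) / √((α i).factorial : ℝ)
  simp only [integral_div, integral_eval_hermiteOfVariance_add_mul] at integral_pi
  rw [← map_pi_eq_stdGaussian, integral_map (by fun_prop) (by fun_prop)]
  exact integral_pi

variable {F : Type*} [NormedAddCommGroup F] [NormedSpace ℝ F] {A : Type*}

/-- The linear combination of the Hermite products `hermiteProd v (α a)` with vector coefficients
`c a`. Given `c` and `α`, letting `v` decrease from `1` to `0` turns an element of the chaos into
its homogeneous part. -/
def hermiteComb (v : ℝ) (α : A → κ → ℕ) (c : A →₀ F) (z : EuclideanSpace ℝ κ) : F :=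
  c.sum fun a y => hermiteProd v (α a) z • y

variable {α : A → κ → ℕ} {c : A →₀ F}

@[fun_prop]
lemma continuous_hermiteComb {T : Type*} [TopologicalSpace T] {v : T → ℝ}
    {z : T → EuclideanSpace ℝ κ} (hv : Continuous v) (hz : Continuous z) :
    Continuous fun t => hermiteComb (v t) α c (z t) := by
  unfold hermiteComb Finsupp.sum
  fun_prop

lemma hermiteComb_sq_mul {k : ℕ} (hα : ∀ a ∈ c.support, ∑ i, α a i = k) (t v : ℝ)
    (z : EuclideanSpace ℝ κ) :
    hermiteComb (t ^ 2 * v) α c (t • z) = t ^ k • hermiteComb v α c z := by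
  simp only [hermiteComb, Finsupp.sum, Finset.smul_sum]
  exact Finset.sum_congr rfl fun a ha => by rw [hermiteProd_sq_mul, hα a ha, mul_smul]

lemma integral_hermiteComb_add_smul [CompleteSpace F] (v σ : ℝ) (x : EuclideanSpace ℝ κ) :
    ∫ z, hermiteComb v α c (x + σ • z) ∂stdGaussian (EuclideanSpace ℝ κ)
      = hermiteComb (v - σ ^ 2) α c x := by
  simp only [hermiteComb, Finsupp.sum]
  rw [integral_finsetSum _ fun a _ => (integrable_hermiteProd_add_smul ..).smul_const _]
  simp only [integral_smul_const, integral_hermiteProd_add_smul]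

end HermiteComb

section MehlerTail

lemma inv_two_le_measure_lt {Ω : Type*} [MeasurableSpace Ω] {μ : Measure Ω}
    [IsProbabilityMeasure μ] {f : Ω → ℝ≥0∞} (hf : Measurable f) {c : ℝ≥0∞} (hc₀ : c ≠ 0)
    (hc : c ≠ ∞) (hfc : ∫⁻ ω, f ω ∂μ ≤ c) : 2⁻¹ ≤ μ {ω | f ω < 2 * c} := by
  have markov : μ {ω | 2 * c ≤ f ω} ≤ 2⁻¹ :=
    calc μ {ω | 2 * c ≤ f ω} ≤ (∫⁻ ω, f ω ∂μ) / (2 * c) :=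
          meas_ge_le_lintegral_div hf.aemeasurable (by simp [hc₀]) (by finiteness)
      _ ≤ c / (2 * c) := by gcongr
      _ = 2⁻¹ := by
          rw [ENNReal.div_eq_inv_mul, ENNReal.mul_inv (by simp) (by simp), mul_assoc,
            ENNReal.inv_mul_cancel hc₀ hc, mul_one]
  have compl_eq : {ω | 2 * c ≤ f ω}ᶜ = {ω | f ω < 2 * c} := by ext; simp
  rw [← compl_eq, prob_compl_eq_one_sub (measurableSet_le measurable_const hf)]
  calc (2⁻¹ : ℝ≥0∞) = 1 - 2⁻¹ := ENNReal.one_sub_inv_two.symm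
    _ ≤ 1 - μ {ω | 2 * c ≤ f ω} := by gcongr

variable {E : Type*} [NormedAddCommGroup E] [InnerProductSpace ℝ E] [FiniteDimensional ℝ E]
  [MeasurableSpace E] [BorelSpace E] {F : Type*} [NormedAddCommGroup F] [NormedSpace ℝ F]
  {Φ : E → F} {k : ℕ}

/-- `Φ` is an eigenfunction, of degree `k`, of the Mehler (Ornstein-Uhlenbeck) semigroup of the
standard Gaussian measure. -/
def IsMehlerEigenfunction (k : ℕ) (Φ : E → F) : Prop :=
  ∀ ρ σ : ℝ, ρ ^ 2 + σ ^ 2 = 1 → ∀ x, ∫ z, Φ (ρ • x + σ • z) ∂stdGaussian E = ρ ^ k • Φ x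

lemma isMehlerEigenfunction_hermiteComb [CompleteSpace F] {κ A : Type*} [Fintype κ]
    {α : A → κ → ℕ} {c : A →₀ F} (hα : ∀ a ∈ c.support, ∑ i, α a i = k) :
    IsMehlerEigenfunction k (hermiteComb 1 α c) := fun ρ σ hρσ x => by
  rw [integral_hermiteComb_add_smul, ← hermiteComb_sq_mul hα, mul_one, ← hρσ, add_sub_cancel_right]

namespace IsMehlerEigenfunction

-- Evaluating the semigroup at `x` instead of `w` amounts to a Cameron-Martin shift.
lemma enorm_pow_smul_le (hΦ : IsMehlerEigenfunction k Φ) (hΦ_cont : Continuous Φ) {ρ σ : ℝ}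
    (hσ : σ ≠ 0) (hρσ : ρ ^ 2 + σ ^ 2 = 1) (x w : E) :
    ‖ρ ^ k • Φ x‖ₑ ≤ ENNReal.ofReal (Real.exp ((ρ / σ) ^ 2 * ‖x - w‖ ^ 2 / 2)) *
      (∫⁻ z, ‖Φ (ρ • w + σ • z)‖ₑ ^ 2 ∂stdGaussian E) ^ (1 / 2 : ℝ) := by
  set h := (ρ / σ) • (x - w) with h_def
  have shift (z : E) : ρ • w + σ • (z + h) = ρ • x + σ • z := by
    rw [h_def, smul_add, smul_smul, mul_div_cancel₀ _ hσ, smul_sub]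
    abel
  have inner_h : innerSL ℝ h h = (ρ / σ) ^ 2 * ‖x - w‖ ^ 2 := by
    rw [innerSL_apply_apply, real_inner_self_eq_norm_sq, h_def, norm_smul, mul_pow,
      Real.norm_eq_abs, sq_abs]
  calc ‖ρ ^ k • Φ x‖ₑ = ‖∫ z, Φ (ρ • w + σ • (z + h)) ∂stdGaussian E‖ₑ := by
        simp only [shift, hΦ ρ σ hρσ]
    _ ≤ ∫⁻ z, ‖Φ (ρ • w + σ • (z + h))‖ₑ ∂stdGaussian E := enorm_integral_le_lintegral_enorm _
    _ ≤ _ := by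
        rw [← inner_h]
        exact lintegral_add_const_le integral_strongDual_stdGaussian
          (covariance_innerSL_stdGaussian · h) (f := fun z => ‖Φ (ρ • w + σ • z)‖ₑ)
          (Continuous.measurable (by fun_prop))

lemma sq_sub_one_lt_norm_sub_sq (hΦ : IsMehlerEigenfunction k Φ) (hΦ_cont : Continuous Φ)
    {r N σ : ℝ} (hr : 0 < r) (hN : 0 < N) (hσ : 0 < σ) (hrσ : r⁻¹ ^ 2 + σ ^ 2 = 1) {x w : E}
    (hx : 3 * r ^ k * N < ‖Φ x‖)
    (hw : ∫⁻ z, ‖Φ (r⁻¹ • w + σ • z)‖ₑ ^ 2 ∂stdGaussian E < 2 * ENNReal.ofReal (N ^ 2)) :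
    r ^ 2 - 1 < ‖x - w‖ ^ 2 := by
  set q := (r⁻¹ / σ) ^ 2 * ‖x - w‖ ^ 2 with q_def
  have three_mul_lt : 3 * N < r⁻¹ ^ k * ‖Φ x‖ := by
    rw [inv_pow, inv_mul_eq_div, lt_div_iff₀ (by positivity)]
    linarith
  have le_exp_mul : r⁻¹ ^ k * ‖Φ x‖ ≤ Real.exp (q / 2) * √(2 * N ^ 2) := by
    rw [← ENNReal.ofReal_le_ofReal_iff (by positivity)]
    calc ENNReal.ofReal (r⁻¹ ^ k * ‖Φ x‖) = ‖r⁻¹ ^ k • Φ x‖ₑ := by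
          rw [← ofReal_norm, norm_smul, Real.norm_of_nonneg (by positivity)]
      _ ≤ _ := hΦ.enorm_pow_smul_le hΦ_cont hσ.ne' hrσ x w
      _ ≤ ENNReal.ofReal (Real.exp (q / 2)) * ENNReal.ofReal (2 * N ^ 2) ^ (1 / 2 : ℝ) := by
          rw [ENNReal.ofReal_mul zero_le_two, ENNReal.ofReal_ofNat]
          gcongr
      _ = ENNReal.ofReal (Real.exp (q / 2) * √(2 * N ^ 2)) := by
          rw [ENNReal.ofReal_rpow_of_pos (by positivity), ← Real.sqrt_eq_rpow,
            ENNReal.ofReal_mul (Real.exp_nonneg _)]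
  have nine_lt : 9 * N ^ 2 < 2 * Real.exp q * N ^ 2 :=
    calc 9 * N ^ 2 = (3 * N) ^ 2 := by ring
      _ < (Real.exp (q / 2) * √(2 * N ^ 2)) ^ 2 := by
          have := three_mul_lt.trans_le le_exp_mul
          gcongr
      _ = 2 * Real.exp q * N ^ 2 := by
          rw [mul_pow, Real.sq_sqrt (by positivity), ← Real.exp_nat_mul, Nat.cast_ofNat,
            mul_div_cancel₀ q two_ne_zero]
          ring
  have one_lt : 1 < q := by
    have := lt_of_mul_lt_mul_right nine_lt (sq_nonneg N)
    exact Real.exp_lt_exp.1 (by linarith [Real.exp_one_lt_d9])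
  have sq_eq : r ^ 2 - 1 = (r * σ) ^ 2 := by
    rw [mul_pow, ← sub_eq_of_eq_add' hrσ.symm]
    field_simp
  rw [sq_eq]
  rwa [q_def, div_pow, inv_pow, div_mul_eq_mul_div, inv_mul_eq_div, div_div, ← mul_pow,
    one_lt_div (by positivity)] at one_lt

lemma measure_lt_norm_le (hΦ : IsMehlerEigenfunction k Φ) (hΦ_cont : Continuous Φ) {r N : ℝ}
    (hr : 1 < r) (hN : 0 < N)
    (hΦN : ∫⁻ z, ‖Φ z‖ₑ ^ 2 ∂stdGaussian E ≤ ENNReal.ofReal (N ^ 2)) :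
    stdGaussian E {z | 3 * r ^ k * N < ‖Φ z‖}
      ≤ 2 * ENNReal.ofReal (Real.exp (-((r ^ 2 - 1) / 4))) := by
  obtain ⟨σ, hσ, hrσ⟩ : ∃ σ : ℝ, 0 < σ ∧ r⁻¹ ^ 2 + σ ^ 2 = 1 := by
    have : r⁻¹ ^ 2 < 1 := by rw [inv_pow]; exact inv_lt_one_of_one_lt₀ (one_lt_pow₀ hr two_ne_zero)
    exact ⟨√(1 - r⁻¹ ^ 2), Real.sqrt_pos.2 (by linarith), by rw [Real.sq_sqrt] <;> linarith⟩
  have measurable_sq : Measurable fun z => ‖Φ z‖ₑ ^ 2 := Continuous.measurable (by fun_prop)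
  set G : E → ℝ≥0∞ := fun w => ∫⁻ z, ‖Φ (r⁻¹ • w + σ • z)‖ₑ ^ 2 ∂stdGaussian E
  have measurable_G : Measurable G := by
    have : Measurable fun p : E × E => ‖Φ (r⁻¹ • p.1 + σ • p.2)‖ₑ ^ 2 :=
      Continuous.measurable (by fun_prop)
    exact this.lintegral_prod_right'
  have lintegral_G : ∫⁻ w, G w ∂stdGaussian E ≤ ENNReal.ofReal (N ^ 2) :=
    (lintegral_lintegral_rotation integral_strongDual_stdGaussian hrσ measurable_sq).trans_le hΦN
  have measure_G_lt : 2⁻¹ ≤ stdGaussian E {w | G w < 2 * ENNReal.ofReal (N ^ 2)} :=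
    inv_two_le_measure_lt measurable_G (by simpa using hN.ne') (by finiteness) lintegral_G
  have concentration := propertyTau_stdGaussian.measure_mul_measure_le (q := (r ^ 2 - 1) / 4)
    (measurableSet_lt measurable_G measurable_const)
    (isOpen_lt continuous_const hΦ_cont.norm).measurableSet fun x hx w hw => by
      have := hΦ.sq_sub_one_lt_norm_sub_sq hΦ_cont (by linarith) hN hσ hrσ hx hw
      linarith
  calc stdGaussian E {z | 3 * r ^ k * N < ‖Φ z‖}
      = 2 * (stdGaussian E {z | 3 * r ^ k * N < ‖Φ z‖} * 2⁻¹) := by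
        rw [mul_left_comm, ENNReal.mul_inv_cancel (by simp) (by simp), mul_one]
    _ ≤ _ := by grw [measure_G_lt, concentration]

end IsMehlerEigenfunction

end MehlerTail

section WienerSpaceCoordinates

variable {B H : Type*} [NormedAddCommGroup B] [NormedSpace ℝ B]
  [NormedAddCommGroup H] [InnerProductSpace ℝ H] [CompleteSpace H] {j : H →L[ℝ] B}
  {ι : Type*} {e : ι → StrongDual ℝ B}

lemma inner_dualToH (j : H →L[ℝ] B) (ℓ : StrongDual ℝ B) (h : H) :
    inner ℝ (dualToH j ℓ) h = ℓ (j h) := by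
  simp [dualToH]

/-- The finitely many coordinates `⟨ξ, e i⟩`, `i ∈ s`, as a vector of a Euclidean space. -/
def coords (e : ι → StrongDual ℝ B) (s : Finset ι) : B →L[ℝ] EuclideanSpace ℝ s :=
  (PiLp.continuousLinearEquiv 2 ℝ fun _ : s => ℝ).symm.toContinuousLinearMap ∘L
    ContinuousLinearMap.pi fun i : s => e i

@[simp]
lemma coords_apply (e : ι → StrongDual ℝ B) (s : Finset ι) (ξ : B) (i : s) :
    coords e s ξ i = e i ξ := rfl

lemma norm_dualToH_innerSL_comp_coords {b : HilbertBasis ι ℝ H}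
    (hb : ∀ i, b i = dualToH j (e i)) (s : Finset ι) (t : EuclideanSpace ℝ s) :
    ‖dualToH j (innerSL ℝ t ∘L coords e s)‖ = ‖t‖ := by
  have eq_sum : dualToH j (innerSL ℝ t ∘L coords e s) = ∑ i : s, t i • b i :=
    ext_inner_right ℝ fun h => by
      simp only [inner_dualToH, hb, sum_inner, real_inner_smul_left]
      simp [PiLp.inner_apply, mul_comm]
  have hb_orthonormal : Orthonormal ℝ fun i : s => b i :=
    b.orthonormal.comp _ Subtype.val_injective
  rw [eq_sum, ← sq_eq_sq₀ (norm_nonneg _) (norm_nonneg _), EuclideanSpace.real_norm_sq_eq,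
    ← real_inner_self_eq_norm_sq, hb_orthonormal.inner_sum]
  simp [sq]

variable [MeasurableSpace B] {μ : Measure B}

namespace IsAbstractWienerSpace

lemma cov_eq_inner (hμ : IsAbstractWienerSpace j μ) (ℓ ℓ' : StrongDual ℝ B) :
    cov[ℓ, ℓ'; μ] = inner ℝ (dualToH j ℓ) (dualToH j ℓ') := by
  simp only [ProbabilityTheory.covariance, hμ.centred, sub_zero, hμ.covariance]

variable [BorelSpace B]

lemma variance_eq_norm_sq (hμ : IsAbstractWienerSpace j μ) (ℓ : StrongDual ℝ B) :
    Var[ℓ; μ] = ‖dualToH j ℓ‖ ^ 2 := by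
  rw [← covariance_self ℓ.continuous.aemeasurable, hμ.cov_eq_inner, real_inner_self_eq_norm_sq]

lemma map_coords (hμ : IsAbstractWienerSpace j μ) {b : HilbertBasis ι ℝ H}
    (hb : ∀ i, b i = dualToH j (e i)) (s : Finset ι) :
    μ.map (coords e s) = stdGaussian (EuclideanSpace ℝ s) := by
  have := hμ.isGaussian
  refine Measure.ext_of_charFun (funext fun t => ?_)
  have integral_eq := integral_cexp_mul_dual hμ.centred (innerSL ℝ t ∘L coords e s) Complex.I
  rw [hμ.variance_eq_norm_sq, norm_dualToH_innerSL_comp_coords hb] at integral_eq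
  rw [charFun_stdGaussian, charFun_apply, integral_map (by fun_prop) (by fun_prop)]
  simpa [real_inner_comm, mul_comm, neg_div] using integral_eq

end IsAbstractWienerSpace
end WienerSpaceCoordinates

section ChaosTail

lemma lintegral_enorm_sq_Lp {Ω F : Type*} [MeasurableSpace Ω] {μ : Measure Ω}
    [NormedAddCommGroup F] (f : Lp F 2 μ) :
    ∫⁻ ξ, ‖f ξ‖ₑ ^ 2 ∂μ = ENNReal.ofReal (‖f‖ ^ 2) := by
  rw [ENNReal.ofReal_pow (norm_nonneg _), ofReal_norm, Lp.enorm_def,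
    eLpNorm_eq_lintegral_rpow_enorm_toReal (by simp) (by simp)]
  simp only [ENNReal.toReal_ofNat, ENNReal.rpow_ofNat]
  rw [← ENNReal.rpow_natCast, ← ENNReal.rpow_mul]
  norm_num

lemma measure_lt_norm_le_of_tendstoInMeasure {Ω F : Type*} [MeasurableSpace Ω] {μ : Measure Ω}
    [NormedAddCommGroup F] {g : ℕ → Ω → F} {f : Ω → F}
    (hgf : TendstoInMeasure μ g atTop f) {a b : ℝ} (hab : a < b) {q : ℝ≥0∞}
    (hg : ∀ᶠ n in atTop, μ {ω | a < ‖g n ω‖} ≤ q) : μ {ω | b < ‖f ω‖} ≤ q := by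
  have hlim := (tendstoInMeasure_iff_norm.1 hgf (b - a) (by linarith)).const_add q
  rw [add_zero] at hlim
  refine ge_of_tendsto hlim (hg.mono fun n hn => ?_)
  calc μ {ω | b < ‖f ω‖} ≤ μ ({ω | a < ‖g n ω‖} ∪ {ω | b - a ≤ ‖g n ω - f ω‖}) := by
        refine measure_mono fun ω (hω : b < ‖f ω‖) => or_iff_not_imp_left.2 fun hgω => ?_
        have := norm_sub_norm_le (f ω) (g n ω)
        rw [norm_sub_rev] at this
        simp only [Set.mem_ofPred_eq, not_lt] at hgω ⊢
        linarith
    _ ≤ q + μ {ω | b - a ≤ ‖g n ω - f ω‖} := by grw [measure_union_le, hn]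

variable {B H : Type*} [NormedAddCommGroup B] [NormedSpace ℝ B]
  [NormedAddCommGroup H] [InnerProductSpace ℝ H] [CompleteSpace H]
  {j : H →L[ℝ] B} {ι : Type*} {e : ι → StrongDual ℝ B} {b : HilbertBasis ι ℝ H}
  {F : Type*} [NormedAddCommGroup F] [NormedSpace ℝ F] {k : ℕ} {c : (ι →₀ ℕ) →₀ F}

/-- The random variable `∑ α, H_α(ξ) c_α`, for a finitely supported family `c` of coefficients. -/
def chaosSum (e : ι → StrongDual ℝ B) : ((ι →₀ ℕ) →₀ F) →ₗ[ℝ] B → F :=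
  Finsupp.lsum ℝ fun α => LinearMap.pi fun ξ => hermiteMulti e α ξ • LinearMap.id

lemma chaosSum_apply (e : ι → StrongDual ℝ B) (c : (ι →₀ ℕ) →₀ F) (ξ : B) :
    chaosSum e c ξ = c.sum fun α y => hermiteMulti e α ξ • y := by
  simp [chaosSum, Finsupp.sum]

lemma hermiteMulti_eq_hermiteProd (e : ι → StrongDual ℝ B) {α : ι →₀ ℕ} {s : Finset ι}
    (hs : α.support ⊆ s) (ξ : B) :
    hermiteMulti e α ξ = hermiteProd 1 (fun i : s => α i) (coords e s ξ) := by
  rw [hermiteMulti, Finsupp.prod_of_support_subset _ hs _ fun i _ => by simp [hermiteFun],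
    ← Finset.prod_coe_sort]
  simp [hermiteProd, hermiteFun, hermiteOfVariance_one, Polynomial.aeval_def,
    Polynomial.eval₂_eq_eval_map]

lemma sum_coe_eq_degree {α : ι →₀ ℕ} {s : Finset ι} (hs : α.support ⊆ s) :
    ∑ i : s, α i = α.degree := by
  rw [Finsupp.degree_apply, Finset.sum_coe_sort s α]
  exact (Finset.sum_subset hs fun i _ hi => by simpa using hi).symm

lemma eventually_chaosSum_eq_hermiteComb (e : ι → StrongDual ℝ B)
    (hc : ∀ α ∈ c.support, α.degree = k) :
    ∀ᶠ s : Finset ι in atTop, (∀ α ∈ c.support, ∑ i : s, α i = k) ∧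
      ∀ ξ, chaosSum e c ξ = hermiteComb 1 (fun α (i : s) => α i) c (coords e s ξ) := by
  classical
  filter_upwards [eventually_ge_atTop (c.support.biUnion Finsupp.support)] with s hs
  have support_subset (α) (hα : α ∈ c.support) : α.support ⊆ s :=
    (Finset.subset_biUnion_of_mem _ hα).trans hs
  refine ⟨fun α hα => (sum_coe_eq_degree (support_subset α hα)).trans (hc α hα), fun ξ => ?_⟩
  rw [chaosSum_apply, hermiteComb]
  exact Finsupp.sum_congr fun α hα => by rw [hermiteMulti_eq_hermiteProd e (support_subset α hα)]

variable [MeasurableSpace B] {μ : Measure B} {f : Lp F 2 μ}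

lemma exists_chaosSum_of_mem_span
    (hf : f ∈ Submodule.span ℝ {f : Lp F 2 μ | ∃ (α : ι →₀ ℕ) (y : F),
      α.degree = k ∧ f =ᵐ[μ] fun ξ => hermiteMulti e α ξ • y}) :
    ∃ c ∈ Finsupp.supported F ℝ {α : ι →₀ ℕ | α.degree = k}, f =ᵐ[μ] chaosSum e c := by
  induction hf using Submodule.span_induction with
  | mem f hf =>
    obtain ⟨α, y, hα, hf⟩ := hf
    refine ⟨Finsupp.single α y, Finsupp.single_mem_supported ℝ y hα, ?_⟩
    filter_upwards [hf] with ξ hξ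
    simp [hξ, chaosSum_apply]
  | zero => exact ⟨0, zero_mem _, by simpa using Lp.coeFn_zero F 2 μ⟩
  | add f g _ _ hf hg =>
    obtain ⟨c, hc, hfc⟩ := hf
    obtain ⟨d, hd, hgd⟩ := hg
    refine ⟨c + d, add_mem hc hd, ?_⟩
    rw [map_add]
    exact (Lp.coeFn_add f g).trans (hfc.add hgd)
  | smul a f _ hf =>
    obtain ⟨c, hc, hfc⟩ := hf
    refine ⟨a • c, Submodule.smul_mem _ a hc, ?_⟩
    rw [map_smul]
    exact (Lp.coeFn_smul a f).trans (hfc.const_smul a)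

lemma exists_seq_chaosSum_tendsto (hf : f ∈ chaos μ e F k) :
    ∃ (g : ℕ → Lp F 2 μ) (c : ℕ → (ι →₀ ℕ) →₀ F), Tendsto g atTop (𝓝 f) ∧
      ∀ n, g n ∈ chaos μ e F k ∧ (∀ α ∈ (c n).support, α.degree = k) ∧
        g n =ᵐ[μ] chaosSum e (c n) := by
  obtain ⟨g, hg, hgf⟩ := mem_closure_iff_seq_limit.1 hf
  choose c hc hgc using fun n => exists_chaosSum_of_mem_span (hg n)
  exact ⟨g, c, hgf, fun n => ⟨Submodule.le_topologicalClosure _ (hg n), hc n, hgc n⟩⟩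

variable [BorelSpace B] [CompleteSpace F]

lemma measure_lt_norm_le_of_ae_eq_chaosSum (hμ : IsAbstractWienerSpace j μ)
    (hb : ∀ i, b i = dualToH j (e i)) (hc : ∀ α ∈ c.support, α.degree = k)
    (hf : f =ᵐ[μ] chaosSum e c) {r N : ℝ} (hr : 1 < r) (hN : 0 < N) (hfN : ‖f‖ ≤ N) :
    μ {ξ | 3 * r ^ k * N < ‖f ξ‖} ≤ 2 * ENNReal.ofReal (Real.exp (-((r ^ 2 - 1) / 4))) := by
  obtain ⟨s, hα, chaosSum_eq⟩ := (eventually_chaosSum_eq_hermiteComb e hc).exists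
  set Φ := hermiteComb 1 (fun (α : ι →₀ ℕ) (i : s) => α i) c
  have hΦ_cont : Continuous Φ := by fun_prop
  have f_ae_eq : f =ᵐ[μ] fun ξ => Φ (coords e s ξ) := hf.trans (.of_forall chaosSum_eq)
  have lintegral_le : ∫⁻ z, ‖Φ z‖ₑ ^ 2 ∂stdGaussian (EuclideanSpace ℝ s)
      ≤ ENNReal.ofReal (N ^ 2) :=
    calc ∫⁻ z, ‖Φ z‖ₑ ^ 2 ∂stdGaussian (EuclideanSpace ℝ s)
        = ∫⁻ ξ, ‖Φ (coords e s ξ)‖ₑ ^ 2 ∂μ := by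
          rw [← hμ.map_coords hb, lintegral_map (Continuous.measurable (by fun_prop)) (by fun_prop)]
      _ = ∫⁻ ξ, ‖f ξ‖ₑ ^ 2 ∂μ := by
        refine lintegral_congr_ae (f_ae_eq.mono fun ξ hξ => ?_)
        simp only [hξ]
      _ = ENNReal.ofReal (‖f‖ ^ 2) := lintegral_enorm_sq_Lp f
      _ ≤ ENNReal.ofReal (N ^ 2) := by gcongr
  calc μ {ξ | 3 * r ^ k * N < ‖f ξ‖}
      = μ (coords e s ⁻¹' {z | 3 * r ^ k * N < ‖Φ z‖}) :=
        measure_congr (eventuallyEq_set.2 (f_ae_eq.mono fun ξ hξ => by simp [hξ]))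
    _ = stdGaussian (EuclideanSpace ℝ s) {z | 3 * r ^ k * N < ‖Φ z‖} := by
        rw [← hμ.map_coords hb, Measure.map_apply (by fun_prop)
          (isOpen_lt continuous_const hΦ_cont.norm).measurableSet]
    _ ≤ _ := (isMehlerEigenfunction_hermiteComb hα).measure_lt_norm_le hΦ_cont hr hN lintegral_le

theorem measure_lt_norm_le_of_mem_chaos (hμ : IsAbstractWienerSpace j μ)
    (hb : ∀ i, b i = dualToH j (e i)) (hf : f ∈ chaos μ e F k) {r N : ℝ} (hr : 1 < r)
    (hfN : ‖f‖ < N) :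
    μ {ξ | 3 * r ^ k * N < ‖f ξ‖} ≤ 2 * ENNReal.ofReal (Real.exp (-((r ^ 2 - 1) / 4))) := by
  obtain ⟨M, hfM, hMN⟩ := exists_between hfN
  have hM : 0 < M := (norm_nonneg f).trans_lt hfM
  obtain ⟨g, c, hgf, hgc⟩ := exists_seq_chaosSum_tendsto hf
  refine measure_lt_norm_le_of_tendstoInMeasure (tendstoInMeasure_of_tendsto_Lp hgf)
    (a := 3 * r ^ k * M) (by gcongr) ?_
  filter_upwards [hgf.norm.eventually_le_const hfM] with n hn
  exact measure_lt_norm_le_of_ae_eq_chaosSum hμ hb (hgc n).2.1 (hgc n).2.2 hr hM hn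

end ChaosTail

section CameronMartinShift

variable {B H : Type*} [NormedAddCommGroup B] [NormedSpace ℝ B]
  [NormedAddCommGroup H] [InnerProductSpace ℝ H] [CompleteSpace H]
  {j : H →L[ℝ] B} {ι : Type*} {e : ι → StrongDual ℝ B} {b : HilbertBasis ι ℝ H}

lemma mem_closure_range_dualToH (hb : ∀ i, b i = dualToH j (e i)) (h : H) :
    h ∈ closure (Set.range (dualToH j)) := by
  refine mem_closure_of_tendsto (b.hasSum_repr h) (.of_forall fun s => ?_)
  refine ⟨∑ i ∈ s, b.repr h i • e i, ext_inner_right ℝ fun x => ?_⟩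
  simp [inner_dualToH, sum_inner, real_inner_smul_left, hb]

namespace IsAbstractWienerSpace

variable [MeasurableSpace B] [BorelSpace B] [CompleteSpace B] [SecondCountableTopology B]
  {μ : Measure B} {F : Type*} [NormedAddCommGroup F]

lemma lintegral_add_dualToH_le (hμ : IsAbstractWienerSpace j μ) (ℓ : StrongDual ℝ B)
    {f : B → ℝ≥0∞} (hf : Measurable f) :
    ∫⁻ ξ, f (ξ + j (dualToH j ℓ)) ∂μ ≤ ENNReal.ofReal (Real.exp (‖dualToH j ℓ‖ ^ 2 / 2)) *
      (∫⁻ ξ, f ξ ^ 2 ∂μ) ^ (1 / 2 : ℝ) := by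
  have := hμ.isGaussian
  rw [← real_inner_self_eq_norm_sq, inner_dualToH]
  exact lintegral_add_const_le hμ.centred (fun L => by rw [hμ.cov_eq_inner, inner_dualToH]) hf

lemma lintegral_add_le_of_lowerSemicontinuous (hμ : IsAbstractWienerSpace j μ)
    (hb : ∀ i, b i = dualToH j (e i)) (h : H) {f : B → ℝ≥0∞} (hf : LowerSemicontinuous f) :
    ∫⁻ ξ, f (ξ + j h) ∂μ ≤ ENNReal.ofReal (Real.exp (‖h‖ ^ 2 / 2)) *
      (∫⁻ ξ, f ξ ^ 2 ∂μ) ^ (1 / 2 : ℝ) := by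
  obtain ⟨g, hg, hgh⟩ := mem_closure_iff_seq_limit.1 (mem_closure_range_dualToH hb h)
  choose ℓ hℓ using hg
  have tendsto_bound : Tendsto (fun n => ENNReal.ofReal (Real.exp (‖g n‖ ^ 2 / 2)) *
      (∫⁻ ξ, f ξ ^ 2 ∂μ) ^ (1 / 2 : ℝ)) atTop (𝓝 (ENNReal.ofReal (Real.exp (‖h‖ ^ 2 / 2)) *
      (∫⁻ ξ, f ξ ^ 2 ∂μ) ^ (1 / 2 : ℝ))) := by
    refine ENNReal.Tendsto.mul_const (ENNReal.tendsto_ofReal ?_) (.inl (by simp [Real.exp_pos]))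
    exact (Real.continuous_exp.tendsto _).comp ((hgh.norm.pow 2).div_const 2)
  calc ∫⁻ ξ, f (ξ + j h) ∂μ ≤ ∫⁻ ξ, liminf (fun n => f (ξ + j (g n))) atTop ∂μ := by
        refine lintegral_mono fun ξ => (lowerSemicontinuousAt_iff_le_liminf.1 (hf _)).trans ?_
        exact (((j.continuous.tendsto h).comp hgh).const_add ξ).liminf_le_liminf_comp
    _ ≤ liminf (fun n => ∫⁻ ξ, f (ξ + j (g n)) ∂μ) atTop :=
        lintegral_liminf_le fun n => hf.measurable.comp (measurable_add_const _)
    _ ≤ liminf (fun n => ENNReal.ofReal (Real.exp (‖g n‖ ^ 2 / 2)) *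
        (∫⁻ ξ, f ξ ^ 2 ∂μ) ^ (1 / 2 : ℝ)) atTop := by
        refine liminf_le_liminf (.of_forall fun n => ?_)
        rw [← hℓ n]
        exact hμ.lintegral_add_dualToH_le (ℓ n) hf.measurable
    _ = _ := tendsto_bound.liminf_eq

lemma lintegral_add_le (hμ : IsAbstractWienerSpace j μ)
    (hb : ∀ i, b i = dualToH j (e i)) (h : H) {f : B → ℝ≥0∞} (hf : Measurable f) :
    ∫⁻ ξ, f (ξ + j h) ∂μ ≤ ENNReal.ofReal (Real.exp (‖h‖ ^ 2 / 2)) *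
      (∫⁻ ξ, f ξ ^ 2 ∂μ) ^ (1 / 2 : ℝ) := by
  have := hμ.isGaussian
  have sqrt_sq (x : ℝ≥0∞) : (x ^ 2) ^ (1 / 2 : ℝ) = x := by
    rw [← ENNReal.rpow_natCast, ← ENNReal.rpow_mul]; norm_num
  have sq_sqrt (x : ℝ≥0∞) : (x ^ (1 / 2 : ℝ)) ^ 2 = x := by
    rw [← ENNReal.rpow_natCast, ← ENNReal.rpow_mul]; norm_num
  have le_add (δ : ℝ≥0∞) (hδ : δ ≠ 0) :
      ∫⁻ ξ, f (ξ + j h) ∂μ ≤ ENNReal.ofReal (Real.exp (‖h‖ ^ 2 / 2)) *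
        (∫⁻ ξ, f ξ ^ 2 ∂μ + δ) ^ (1 / 2 : ℝ) := by
    obtain ⟨g, hfg, hg, hg_lintegral⟩ := exists_le_lowerSemicontinuous_lintegral_ge μ
      (fun ξ => f ξ ^ 2) (hf.pow_const 2) hδ
    have hg_sqrt : LowerSemicontinuous fun ξ => g ξ ^ (1 / 2 : ℝ) :=
      ENNReal.continuous_rpow_const.comp_lowerSemicontinuous hg
        (ENNReal.monotone_rpow_of_nonneg (by norm_num))
    calc ∫⁻ ξ, f (ξ + j h) ∂μ ≤ ∫⁻ ξ, g (ξ + j h) ^ (1 / 2 : ℝ) ∂μ :=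
          lintegral_mono fun ξ => by grw [← hfg (ξ + j h), sqrt_sq]
      _ ≤ _ := hμ.lintegral_add_le_of_lowerSemicontinuous hb h hg_sqrt
      _ ≤ _ := by simp only [sq_sqrt]; gcongr
  have continuous_bound : Continuous fun δ : ℝ≥0∞ => ENNReal.ofReal (Real.exp (‖h‖ ^ 2 / 2)) *
      (∫⁻ ξ, f ξ ^ 2 ∂μ + δ) ^ (1 / 2 : ℝ) :=
    (ENNReal.continuous_const_mul ENNReal.ofReal_ne_top).comp
      (ENNReal.continuous_rpow_const.comp (continuous_const.add continuous_id))
  have tendsto_bound := (continuous_bound.tendsto 0).mono_left (nhdsWithin_le_nhds (s := {0}ᶜ))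
  rw [add_zero] at tendsto_bound
  exact ge_of_tendsto tendsto_bound (eventually_mem_nhdsWithin.mono le_add)

lemma quasiMeasurePreserving_add (hμ : IsAbstractWienerSpace j μ)
    (hb : ∀ i, b i = dualToH j (e i)) (h : H) :
    Measure.QuasiMeasurePreserving (fun ξ => ξ + j h) μ μ := by
  refine ⟨measurable_add_const _, Measure.AbsolutelyContinuous.mk fun A hA hA_zero => ?_⟩
  have shift_le := hμ.lintegral_add_le hb h (measurable_one.indicator hA)
  have sq_indicator (ξ) : A.indicator (1 : B → ℝ≥0∞) ξ ^ 2 = A.indicator 1 ξ := by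
    by_cases hξ : ξ ∈ A <;> simp [hξ]
  have lintegral_indicator_eq : ∫⁻ ξ, A.indicator (1 : B → ℝ≥0∞) (ξ + j h) ∂μ
      = μ.map (· + j h) A := by
    rw [← lintegral_indicator_one hA, lintegral_map (by fun_prop) (by fun_prop)]
  simpa [sq_indicator, lintegral_indicator_eq, lintegral_indicator_one hA, hA_zero] using shift_le

lemma lintegral_enorm_add_le (hμ : IsAbstractWienerSpace j μ)
    (hb : ∀ i, b i = dualToH j (e i)) (h : H) (f : Lp F 2 μ) :
    ∫⁻ ξ, ‖f (ξ + j h)‖ₑ ∂μ ≤ ENNReal.ofReal (Real.exp (‖h‖ ^ 2 / 2) * ‖f‖) := by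
  have hf : Measurable fun ξ => ‖f ξ‖ₑ := (Lp.stronglyMeasurable f).enorm
  refine (hμ.lintegral_add_le hb h hf).trans_eq ?_
  rw [lintegral_enorm_sq_Lp, ENNReal.ofReal_rpow_of_nonneg (by positivity) (by norm_num),
    ← Real.sqrt_eq_rpow, Real.sqrt_sq (norm_nonneg _), ENNReal.ofReal_mul (Real.exp_nonneg _)]

lemma integrable_add (hμ : IsAbstractWienerSpace j μ)
    (hb : ∀ i, b i = dualToH j (e i)) (h : H) (f : Lp F 2 μ) :
    Integrable (fun ξ => f (ξ + j h)) μ :=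
  ⟨(Lp.stronglyMeasurable f).aestronglyMeasurable.comp_quasiMeasurePreserving
    (hμ.quasiMeasurePreserving_add hb h),
    (hμ.lintegral_enorm_add_le hb h f).trans_lt ENNReal.ofReal_lt_top⟩

variable [NormedSpace ℝ F]

lemma norm_integral_add_sub_le (hμ : IsAbstractWienerSpace j μ)
    (hb : ∀ i, b i = dualToH j (e i)) (h : H) (f g : Lp F 2 μ) :
    ‖∫ ξ, f (ξ + j h) ∂μ - ∫ ξ, g (ξ + j h) ∂μ‖ ≤ Real.exp (‖h‖ ^ 2 / 2) * ‖f - g‖ := by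
  have sub_ae_eq : (fun ξ => (f - g) (ξ + j h)) =ᵐ[μ] fun ξ => f (ξ + j h) - g (ξ + j h) :=
    (hμ.quasiMeasurePreserving_add hb h).ae_eq_comp (Lp.coeFn_sub f g)
  rw [← integral_sub (hμ.integrable_add hb h f) (hμ.integrable_add hb h g),
    ← integral_congr_ae sub_ae_eq, ← ENNReal.ofReal_le_ofReal_iff (by positivity), ofReal_norm]
  exact (enorm_integral_le_lintegral_enorm _).trans (hμ.lintegral_enorm_add_le hb h (f - g))

lemma integral_add_eq_hermiteComb [CompleteSpace F] (hμ : IsAbstractWienerSpace j μ)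
    (hb : ∀ i, b i = dualToH j (e i)) (h : H) {f : Lp F 2 μ} {A : Type*} {s : Finset ι}
    {α : A → s → ℕ} {c : A →₀ F} (hf : f =ᵐ[μ] fun ξ => hermiteComb 1 α c (coords e s ξ)) :
    ∫ ξ, f (ξ + j h) ∂μ = hermiteComb 0 α c (coords e s (j h)) := by
  have shift_ae_eq : (fun ξ => f (ξ + j h)) =ᵐ[μ]
      fun ξ => hermiteComb 1 α c (coords e s (j h) + coords e s ξ) := by
    simpa only [Function.comp_def, map_add, add_comm] using
      (hμ.quasiMeasurePreserving_add hb h).ae_eq_comp hf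
  have integral_shift := integral_hermiteComb_add_smul (α := α) (c := c) 1 1 (coords e s (j h))
  rw [← hμ.map_coords hb, integral_map (by fun_prop)
    (Continuous.aestronglyMeasurable (by fun_prop))] at integral_shift
  rw [integral_congr_ae shift_ae_eq]
  simpa using integral_shift

end IsAbstractWienerSpace

end CameronMartinShift

section ExponentialScale

lemma mul_log_ofReal_exp {ε : ℝ} (hε : 0 < ε) (a : ℝ) :
    (ε : EReal) * ENNReal.log (ENNReal.ofReal (Real.exp (-a / ε))) = -(a : EReal) := by
  rw [ENNReal.log_ofReal, if_neg (not_le.2 (Real.exp_pos _)), Real.log_exp, ← EReal.coe_mul,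
    mul_div_cancel₀ _ hε.ne', EReal.coe_neg]

lemma limsup_mul_log_le {m : ℝ → ℝ≥0∞} {L : EReal}
    (hm : ∀ a : ℝ, (a : EReal) < L →
      ∀ᶠ ε in 𝓝[>] (0 : ℝ), m ε ≤ ENNReal.ofReal (Real.exp (-a / ε))) :
    limsup (fun ε : ℝ => (ε : EReal) * ENNReal.log (m ε)) (𝓝[>] 0) ≤ -L := by
  refine EReal.le_neg_of_le_neg (EReal.ge_of_forall_gt_iff_ge.1 fun a ha => ?_)
  refine EReal.le_neg_of_le_neg (limsup_le_of_le (by isBoundedDefault) ?_)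
  filter_upwards [hm a ha, eventually_mem_nhdsWithin] with ε hmε (hε : 0 < ε)
  rw [← mul_log_ofReal_exp hε a]
  exact mul_le_mul_of_nonneg_left (ENNReal.log_le_log hmε) (EReal.coe_nonneg.2 hε.le)

lemma le_liminf_mul_log {m : ℝ → ℝ≥0∞} {L : EReal}
    (hm : ∀ a : ℝ, L < (a : EReal) →
      ∀ᶠ ε in 𝓝[>] (0 : ℝ), ENNReal.ofReal (Real.exp (-a / ε)) ≤ m ε) :
    -L ≤ liminf (fun ε : ℝ => (ε : EReal) * ENNReal.log (m ε)) (𝓝[>] 0) := by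
  refine EReal.neg_le_of_neg_le (EReal.le_of_forall_lt_iff_le.1 fun a ha => ?_)
  refine EReal.neg_le_of_neg_le (le_liminf_of_le (by isBoundedDefault) ?_)
  filter_upwards [hm a ha, eventually_mem_nhdsWithin] with ε hmε (hε : 0 < ε)
  rw [← mul_log_ofReal_exp hε a]
  exact mul_le_mul_of_nonneg_left (ENNReal.log_le_log hmε) (EReal.coe_nonneg.2 hε.le)

lemma eventually_const_mul_exp_le {A : ℝ≥0∞} (hA : A ≠ ∞) {a' a : ℝ} (ha : a' < a) :
    ∀ᶠ ε in 𝓝[>] (0 : ℝ),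
      A * ENNReal.ofReal (Real.exp (-a / ε)) ≤ ENNReal.ofReal (Real.exp (-a' / ε)) := by
  have tendsto_exp : Tendsto (fun ε : ℝ => Real.exp ((a - a') * ε⁻¹)) (𝓝[>] 0) atTop :=
    Real.tendsto_exp_atTop.comp (tendsto_inv_nhdsGT_zero.const_mul_atTop (by linarith))
  filter_upwards [tendsto_exp.eventually_ge_atTop A.toReal] with ε hε
  calc A * ENNReal.ofReal (Real.exp (-a / ε))
      = ENNReal.ofReal (A.toReal * Real.exp (-a / ε)) := by
        rw [ENNReal.ofReal_mul ENNReal.toReal_nonneg, ENNReal.ofReal_toReal hA]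
    _ ≤ ENNReal.ofReal (Real.exp ((a - a') * ε⁻¹) * Real.exp (-a / ε)) := by gcongr
    _ = ENNReal.ofReal (Real.exp (-a' / ε)) := by
        rw [← Real.exp_add]
        ring_nf

end ExponentialScale

section GaussianLargeDeviations

lemma integrable_exp_mul_sq_gaussianReal {θ : ℝ} (hθ : θ < 1) :
    Integrable (fun x : ℝ => Real.exp (θ * x ^ 2 / 2)) (gaussianReal 0 1) := by
  rw [gaussianReal_of_var_ne_zero 0 one_ne_zero,
    integrable_withDensity_iff (measurable_gaussianPDF 0 1)
      (.of_forall fun _ => gaussianPDF_lt_top)]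
  have integrable_exp_neg :=
    (integrable_exp_neg_mul_sq (b := (1 - θ) / 2) (by linarith)).const_mul (√(2 * Real.pi))⁻¹
  refine integrable_exp_neg.congr (.of_forall fun x => ?_)
  simp only [toReal_gaussianPDF, gaussianPDFReal_def, NNReal.coe_one, mul_one, sub_zero]
  rw [mul_left_comm, ← Real.exp_add]
  ring_nf

variable {E : Type*} [NormedAddCommGroup E] [InnerProductSpace ℝ E] [FiniteDimensional ℝ E]
  [MeasurableSpace E] [BorelSpace E]

lemma integrable_exp_mul_norm_sq_stdGaussian {θ : ℝ} (hθ : θ < 1) :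
    Integrable (fun z : E => Real.exp (θ * ‖z‖ ^ 2 / 2)) (stdGaussian E) := by
  rw [stdGaussian, integrable_map_measure (by fun_prop)
    (Measurable.aemeasurable (by fun_prop))]
  have integrable_prod := Integrable.fintype_prod (f := fun _ x => Real.exp (θ * x ^ 2 / 2))
    fun _ : Fin (Module.finrank ℝ E) => integrable_exp_mul_sq_gaussianReal hθ
  refine integrable_prod.congr (.of_forall fun x => ?_)
  have norm_sq_eq : ‖∑ i, x i • stdOrthonormalBasis ℝ E i‖ ^ 2 = ∑ i, x i ^ 2 := by
    rw [← real_inner_self_eq_norm_sq, (stdOrthonormalBasis ℝ E).orthonormal.inner_sum]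
    simp [sq]
  simp only [Function.comp_apply, norm_sq_eq]
  rw [← Real.exp_sum, Finset.mul_sum, Finset.sum_div]

lemma eventually_stdGaussian_lt_norm_le {a' a : ℝ} (ha₀ : 0 < a) (ha : a' < a) :
    ∀ᶠ ε in 𝓝[>] (0 : ℝ), stdGaussian E {z | a < ‖√ε • z‖ ^ 2 / 2}
      ≤ ENNReal.ofReal (Real.exp (-a' / ε)) := by
  obtain ⟨θ, hθ, hθ_one⟩ := exists_between (max_lt zero_lt_one ((div_lt_one ha₀).2 ha))
  have hθ_pos : 0 < θ := (le_max_left _ _).trans_lt hθ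
  have hθa : a' < θ * a := (div_lt_iff₀ ha₀).1 ((le_max_right _ _).trans_lt hθ)
  set A := ∫⁻ z : E, ENNReal.ofReal (Real.exp (θ * ‖z‖ ^ 2 / 2)) ∂stdGaussian E
  have hA : A ≠ ∞ := (integrable_exp_mul_norm_sq_stdGaussian hθ_one).lintegral_lt_top.ne
  filter_upwards [eventually_const_mul_exp_le hA hθa, eventually_mem_nhdsWithin]
    with ε hAε (hε : 0 < ε)
  calc stdGaussian E {z | a < ‖√ε • z‖ ^ 2 / 2}
      ≤ stdGaussian E {z | ENNReal.ofReal (Real.exp (θ * a / ε)) ≤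
          ENNReal.ofReal (Real.exp (θ * ‖z‖ ^ 2 / 2))} := by
        refine measure_mono fun z (hz : a < ‖√ε • z‖ ^ 2 / 2) => ?_
        rw [norm_smul, mul_pow, Real.norm_of_nonneg (Real.sqrt_nonneg _), Real.sq_sqrt hε.le] at hz
        refine ENNReal.ofReal_le_ofReal (Real.exp_le_exp.2 ?_)
        rw [div_le_iff₀ hε]
        nlinarith
    _ ≤ A / ENNReal.ofReal (Real.exp (θ * a / ε)) :=
        meas_ge_le_lintegral_div (by fun_prop) (by simp [Real.exp_pos]) ENNReal.ofReal_ne_top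
    _ = A * ENNReal.ofReal (Real.exp (-(θ * a) / ε)) := by
        rw [div_eq_mul_inv, ← ENNReal.ofReal_inv_of_pos (Real.exp_pos _), ← Real.exp_neg, neg_div]
    _ ≤ ENNReal.ofReal (Real.exp (-a' / ε)) := hAε

lemma exp_mul_stdGaussian_closedBall_le {ε : ℝ} (hε : 0 < ε) (x : E) (r : ℝ) :
    ENNReal.ofReal (Real.exp (-(‖x‖ ^ 2 / 2) / ε)) * stdGaussian E {z | ‖√ε • z‖ ≤ r}
      ≤ stdGaussian E {z | ‖√ε • z - x‖ ≤ r} := by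
  have hε_sqrt : √ε ≠ 0 := (Real.sqrt_pos.2 hε).ne'
  have shift := exp_mul_measure_le_measure_add_const integral_strongDual_stdGaussian
    (fun L => covariance_innerSL_stdGaussian L (-(√ε)⁻¹ • x))
    (A := {z | ‖√ε • z‖ ≤ r}) (isClosed_le (by fun_prop) continuous_const).measurableSet (by simp)
  convert! shift using 3
  · rw [innerSL_apply_apply, real_inner_self_eq_norm_sq, norm_smul, mul_pow]
    simp only [norm_neg, norm_inv, Real.norm_eq_abs, inv_pow, sq_abs, Real.sq_sqrt hε.le,
      Real.exp_eq_exp]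
    ring
  · ext z
    simp [smul_add, hε_sqrt, sub_eq_add_neg]

lemma eventually_exp_le_stdGaussian_norm_sub_le {x : E} {a : ℝ} (ha : ‖x‖ ^ 2 / 2 < a) {r : ℝ}
    (hr : 0 < r) :
    ∀ᶠ ε in 𝓝[>] (0 : ℝ), ENNReal.ofReal (Real.exp (-a / ε))
      ≤ stdGaussian E {z | ‖√ε • z - x‖ ≤ r} := by
  filter_upwards [eventually_stdGaussian_lt_norm_le (E := E) (a := r ^ 2 / 2) (a' := r ^ 2 / 4)
      (by positivity) (by linarith [sq_pos_of_pos hr]),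
    eventually_const_mul_exp_le (A := 2) (by simp) (a' := 0) (a := r ^ 2 / 4) (by positivity),
    eventually_const_mul_exp_le (A := 2) (by simp) ha, eventually_mem_nhdsWithin]
    with ε tail_le exp_le_half exp_le (hε : 0 < ε)
  have one_le : 1 ≤ 2 * stdGaussian E {z | ‖√ε • z‖ ≤ r} := by
    have compl_le : stdGaussian E {z | ‖√ε • z‖ ≤ r}ᶜ
        ≤ ENNReal.ofReal (Real.exp (-(r ^ 2 / 4) / ε)) := by
      refine (measure_mono fun z hz => ?_).trans tail_le
      have hrz : r < ‖√ε • z‖ := not_le.1 hz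
      change r ^ 2 / 2 < ‖√ε • z‖ ^ 2 / 2
      gcongr
    have one_add_one_le : (1 : ℝ≥0∞) + 1 ≤ 2 * stdGaussian E {z | ‖√ε • z‖ ≤ r} + 1 := by
      calc (1 : ℝ≥0∞) + 1
          = 2 * (stdGaussian E {z | ‖√ε • z‖ ≤ r} + stdGaussian E {z | ‖√ε • z‖ ≤ r}ᶜ) := by
            rw [prob_add_prob_compl (isClosed_le (by fun_prop) continuous_const).measurableSet,
              mul_one, one_add_one_eq_two]
        _ ≤ 2 * stdGaussian E {z | ‖√ε • z‖ ≤ r} + 1 := by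
            rw [mul_add]
            gcongr
            simpa using (mul_le_mul_right compl_le 2).trans exp_le_half
    exact (ENNReal.add_le_add_iff_right ENNReal.one_ne_top).1 one_add_one_le
  calc ENNReal.ofReal (Real.exp (-a / ε))
      ≤ ENNReal.ofReal (Real.exp (-a / ε)) * (2 * stdGaussian E {z | ‖√ε • z‖ ≤ r}) :=
        le_mul_of_one_le_right' one_le
    _ = 2 * ENNReal.ofReal (Real.exp (-a / ε)) * stdGaussian E {z | ‖√ε • z‖ ≤ r} := by ring
    _ ≤ ENNReal.ofReal (Real.exp (-(‖x‖ ^ 2 / 2) / ε)) * stdGaussian E {z | ‖√ε • z‖ ≤ r} := by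
        gcongr
    _ ≤ stdGaussian E {z | ‖√ε • z - x‖ ≤ r} := exp_mul_stdGaussian_closedBall_le hε x r

end GaussianLargeDeviations

section ContractedRate

variable {H S : Type*} [NormedAddCommGroup H] {F : H → S}

/-- The rate function `y ↦ inf {|h|² / 2 : F h = y}` obtained from `h ↦ |h|² / 2` by contraction
along `F`. -/
def contractedRate (F : H → S) (y : S) : ℝ≥0∞ :=
  ⨅ (h : H) (_ : F h = y), ENNReal.ofReal (‖h‖ ^ 2 / 2)

lemma contractedRate_le (F : H → S) (h : H) :
    contractedRate F (F h) ≤ ENNReal.ofReal (‖h‖ ^ 2 / 2) :=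
  iInf₂_le_of_le h rfl le_rfl

lemma contractedRate_lt_iff {y : S} {a : ℝ} (ha : 0 < a) :
    contractedRate F y < ENNReal.ofReal a ↔ ∃ h, F h = y ∧ ‖h‖ ^ 2 / 2 < a := by
  simp only [contractedRate, iInf_lt_iff, exists_prop, ENNReal.ofReal_lt_ofReal_iff ha]

lemma setOf_contractedRate_le (F : H → S) (c : ℝ≥0) :
    {y | contractedRate F y ≤ c}
      = ⋂ n : ℕ, F '' Metric.closedBall 0 (√(2 * (c + 1 / ((n : ℝ) + 1)))) := by
  have one_div_pos (n : ℕ) : (0 : ℝ) < 1 / ((n : ℝ) + 1) := by positivity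
  ext y
  simp only [Set.mem_ofPred_eq, Set.mem_iInter]
  refine ⟨fun hy n => ?_, fun hy => ?_⟩
  · have rate_lt : contractedRate F y < ENNReal.ofReal (c + 1 / ((n : ℝ) + 1)) := by
      refine hy.trans_lt (ENNReal.lt_ofReal_iff_toReal_lt ENNReal.coe_ne_top |>.2 ?_)
      simpa using one_div_pos n
    obtain ⟨h, rfl, hh⟩ := (contractedRate_lt_iff (by positivity)).1 rate_lt
    exact ⟨h, mem_closedBall_zero_iff.2 (Real.le_sqrt_of_sq_le (by linarith)), rfl⟩
  · have hlim : Tendsto (fun n : ℕ => ENNReal.ofReal (c + 1 / ((n : ℝ) + 1))) atTop (𝓝 c) := by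
      simpa using
        ENNReal.tendsto_ofReal (tendsto_one_div_add_atTop_nhds_zero_nat.const_add (c : ℝ))
    refine ge_of_tendsto' hlim fun n => ?_
    obtain ⟨h, hh, rfl⟩ := hy n
    refine (contractedRate_le F h).trans (ENNReal.ofReal_le_ofReal ?_)
    have := (Real.le_sqrt (norm_nonneg _) (by positivity)).1 (mem_closedBall_zero_iff.1 hh)
    linarith

lemma notMem_of_lt_iInf_contractedRate {C : Set S} {a : ℝ}
    (ha : (a : EReal) < ((⨅ y ∈ C, contractedRate F y : ℝ≥0∞) : EReal)) {h : H}
    (hh : ‖h‖ ^ 2 / 2 ≤ a) : F h ∉ C := fun hC => by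
  refine ha.not_ge ?_
  calc ((⨅ y ∈ C, contractedRate F y : ℝ≥0∞) : EReal)
      ≤ (ENNReal.ofReal a : EReal) := EReal.coe_ennreal_le_coe_ennreal_iff.2 <|
        (iInf₂_le _ hC).trans ((contractedRate_le F h).trans (ENNReal.ofReal_le_ofReal hh))
    _ = a := by rw [EReal.coe_ennreal_ofReal, max_eq_left ((by positivity : (0 : ℝ) ≤ _).trans hh)]

lemma exists_mem_of_iInf_contractedRate_lt {O : Set S} {a : ℝ}
    (ha : ((⨅ y ∈ O, contractedRate F y : ℝ≥0∞) : EReal) < a) :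
    ∃ h, F h ∈ O ∧ ‖h‖ ^ 2 / 2 < a := by
  have ha_pos : 0 < a := EReal.coe_pos.1 ((EReal.coe_ennreal_nonneg _).trans_lt ha)
  have iInf_lt : ⨅ y ∈ O, contractedRate F y < ENNReal.ofReal a := by
    rwa [← EReal.coe_ennreal_lt_coe_ennreal_iff, EReal.coe_ennreal_ofReal, max_eq_left ha_pos.le]
  simp only [iInf_lt_iff, contractedRate_lt_iff ha_pos] at iInf_lt
  obtain ⟨_, hO, h, rfl, hh⟩ := iInf_lt
  exact ⟨h, hO, hh⟩

end ContractedRate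

section Coordinates

variable {B H : Type*} [NormedAddCommGroup B] [NormedSpace ℝ B]
  [NormedAddCommGroup H] [InnerProductSpace ℝ H] [CompleteSpace H]
  {j : H →L[ℝ] B} {ι : Type*} {e : ι → StrongDual ℝ B} {b : HilbertBasis ι ℝ H}

lemma norm_coords_le (hb : ∀ i, b i = dualToH j (e i)) (s : Finset ι) (h : H) :
    ‖coords e s (j h)‖ ≤ ‖h‖ := by
  rw [← sq_le_sq₀ (norm_nonneg _) (norm_nonneg _), EuclideanSpace.real_norm_sq_eq]
  have bessel := b.orthonormal.sum_inner_products_le h (s := s)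
  simp only [hb, inner_dualToH, Real.norm_eq_abs, sq_abs] at bessel
  simpa only [coords_apply, Finset.sum_coe_sort s fun i => e i (j h) ^ 2] using bessel

lemma exists_coords_eq (hb : ∀ i, b i = dualToH j (e i)) (s : Finset ι)
    (x : EuclideanSpace ℝ s) : ∃ h : H, coords e s (j h) = x ∧ ‖h‖ = ‖x‖ := by
  classical
  refine ⟨dualToH j (innerSL ℝ x ∘L coords e s), ?_, norm_dualToH_innerSL_comp_coords hb s x⟩
  ext i
  have coords_basis : coords e s (j (b i)) = EuclideanSpace.single i 1 := by
    ext k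
    rw [coords_apply, ← inner_dualToH, ← hb, orthonormal_iff_ite.1 b.orthonormal]
    rw [EuclideanSpace.single, PiLp.single_apply]
    exact if_congr Subtype.ext_iff.symm rfl rfl
  rw [coords_apply, ← inner_dualToH, ← hb, real_inner_comm, inner_dualToH]
  simp [coords_basis, EuclideanSpace.inner_single_right]

end Coordinates

section ExpApprox

variable {B H : Type*} [NormedAddCommGroup B] [NormedSpace ℝ B] [MeasurableSpace B]
  [NormedAddCommGroup H] [InnerProductSpace ℝ H]
  {j : H →L[ℝ] B} {μ : Measure B} {ι : Type*} {e : ι → StrongDual ℝ B}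
  {S : Type*} [PseudoMetricSpace S] {X : ℝ → B → S} {F : H → S}

variable (j μ e) in
/-- The random variables `X ε` are approximated, up to events of probability `exp (-R / ε)` with
`R` arbitrarily large, by continuous functions of `ε` and of finitely many of the rescaled
coordinates `√ε ⟨ξ, e i⟩`, whose values at `ε = 0` approximate `F` uniformly on bounded sets.
Every sufficiently large finite set of coordinates has to work, so that finitely many
approximations can be combined. -/
def HasExpApprox (X : ℝ → B → S) (F : H → S) : Prop :=
  ∀ η > 0, ∀ R : ℝ, ∀ᶠ s : Finset ι in atTop, ∃ P : ℝ × EuclideanSpace ℝ s → S,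
    Continuous P ∧ (∀ h, ‖h‖ ≤ R → dist (P (0, coords e s (j h))) (F h) < η) ∧
    ∀ᶠ ε in 𝓝[>] (0 : ℝ), μ {ξ | η ≤ dist (X ε ξ) (P (ε, √ε • coords e s ξ))}
      ≤ ENNReal.ofReal (Real.exp (-R / ε))

namespace HasExpApprox

lemma congr_ae (happ : HasExpApprox j μ e X F) {X' : ℝ → B → S}
    (hX : ∀ᶠ ε in 𝓝[>] (0 : ℝ), X ε =ᵐ[μ] X' ε) : HasExpApprox j μ e X' F := by
  intro η hη R
  filter_upwards [happ η hη R] with s ⟨P, hP, hPF, hXP⟩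
  refine ⟨P, hP, hPF, ?_⟩
  filter_upwards [hXP, hX] with ε hXPε hXε
  refine (measure_mono_ae ?_).trans hXPε
  filter_upwards [hXε] with ξ hξ (hdist : η ≤ dist (X' ε ξ) _)
  exact hdist.trans_eq (congrArg (dist · _) hξ.symm)

lemma comp_uniformContinuous (happ : HasExpApprox j μ e X F) {S' : Type*} [PseudoMetricSpace S']
    {G : S → S'} (hG : UniformContinuous G) :
    HasExpApprox j μ e (fun ε ξ => G (X ε ξ)) (fun h => G (F h)) := by
  intro η hη R
  obtain ⟨δ, hδ, hGδ⟩ := Metric.uniformContinuous_iff.1 hG η hη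
  filter_upwards [happ δ hδ R] with s ⟨P, hP, hPF, hXP⟩
  refine ⟨fun p => G (P p), hG.continuous.comp hP, fun h hh => hGδ (hPF h hh), ?_⟩
  filter_upwards [hXP] with ε hXPε
  refine (measure_mono fun ξ (hξ : η ≤ dist (G _) (G _)) => ?_).trans hXPε
  exact not_lt.1 fun hlt => hξ.not_gt (hGδ hlt)

lemma pi {T : Type*} [Fintype T] {S : T → Type*} [∀ t, PseudoMetricSpace (S t)]
    {X : ∀ t, ℝ → B → S t} {F : ∀ t, H → S t} (happ : ∀ t, HasExpApprox j μ e (X t) (F t)) :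
    HasExpApprox j μ e (fun ε ξ t => X t ε ξ) (fun h t => F t h) := by
  intro η hη R
  filter_upwards [eventually_all.2 fun t => happ t η hη (R + 1)] with s hs
  choose P hP hPF hXP using hs
  refine ⟨fun p t => P t p, continuous_pi hP, fun h hh => ?_, ?_⟩
  · exact (dist_pi_lt_iff hη).2 fun t => hPF t h (hh.trans (by linarith))
  filter_upwards [eventually_all.2 hXP,
    eventually_const_mul_exp_le (ENNReal.natCast_ne_top (Fintype.card T)) (lt_add_one R)]
    with ε hXPε hexp
  calc μ {ξ | η ≤ dist (fun t => X t ε ξ) (fun t => P t (ε, √ε • coords e s ξ))}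
      ≤ μ (⋃ t, {ξ | η ≤ dist (X t ε ξ) (P t (ε, √ε • coords e s ξ))}) := by
        refine measure_mono fun ξ (hξ : η ≤ _) => Set.mem_iUnion.2 ?_
        by_contra! hlt
        exact hξ.not_gt ((dist_pi_lt_iff hη).2 fun t => not_le.1 (hlt t))
    _ ≤ ∑ t : T, ENNReal.ofReal (Real.exp (-(R + 1) / ε)) :=
        (measure_iUnion_fintype_le _ _).trans (Finset.sum_le_sum fun t _ => hXPε t)
    _ ≤ ENNReal.ofReal (Real.exp (-R / ε)) := by simpa using hexp

lemma smul {S : Type*} [SeminormedAddCommGroup S] [NormedSpace ℝ S] {X : ℝ → B → S} {F : H → S}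
    (happ : HasExpApprox j μ e X F) {a : ℝ → ℝ} (ha : Continuous a)
    (ha_le : ∀ ε ∈ Set.Icc 0 1, ‖a ε‖ ≤ 1) :
    HasExpApprox j μ e (fun ε ξ => a ε • X ε ξ) (fun h => a 0 • F h) := by
  have dist_smul_le {ε : ℝ} (hε : ε ∈ Set.Icc 0 1) (x y : S) :
      dist (a ε • x) (a ε • y) ≤ dist x y := by
    rw [dist_smul₀]
    exact mul_le_of_le_one_left dist_nonneg (ha_le ε hε)
  intro η hη R
  filter_upwards [happ η hη R] with s ⟨P, hP, hPF, hXP⟩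
  refine ⟨fun p => a p.1 • P p, by fun_prop,
    fun h hh => (dist_smul_le (by simp) _ _).trans_lt (hPF h hh), ?_⟩
  filter_upwards [hXP, Ioo_mem_nhdsGT one_pos] with ε hXPε hε
  exact (measure_mono fun ξ hξ =>
    le_trans hξ (dist_smul_le (Set.Ioo_subset_Icc_self hε) _ _)).trans hXPε

end HasExpApprox
end ExpApprox

section LargeDeviations

lemma eventually_dist_lt_of_norm_le {E S : Type*} [NormedAddCommGroup E] [ProperSpace E]
    [PseudoMetricSpace S] {P : ℝ × E → S} (hP : Continuous P) {η : ℝ} (hη : 0 < η) (R : ℝ) :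
    ∀ᶠ t in 𝓝 (0 : ℝ), ∀ z, ‖z‖ ≤ R → dist (P (t, z)) (P (0, z)) < η := by
  have isOpen_dist_lt : IsOpen {p : ℝ × E | dist (P p) (P (0, p.2)) < η} :=
    isOpen_lt (by fun_prop) continuous_const
  simpa only [mem_closedBall_zero_iff] using
    (isCompact_closedBall (0 : E) R).eventually_forall_of_forall_eventually (x₀ := (0 : ℝ))
      (P := fun t z => dist (P (t, z)) (P (0, z)) < η)
      fun z _ => isOpen_dist_lt.mem_nhds (by simpa using hη)

variable {B H : Type*} [NormedAddCommGroup B] [NormedSpace ℝ B] [MeasurableSpace B]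
  [NormedAddCommGroup H] [InnerProductSpace ℝ H] [CompleteSpace H]
  {j : H →L[ℝ] B} {μ : Measure B} {ι : Type*} {e : ι → StrongDual ℝ B} {b : HilbertBasis ι ℝ H}
  {S : Type*}

namespace HasExpApprox

-- On bounded sets `F` is a uniform limit of weakly continuous functions, and balls of `H` are
-- weakly compact.
lemma isCompact_image_closedBall [PseudoMetricSpace S] {X : ℝ → B → S} {F : H → S}
    (happ : HasExpApprox j μ e X F) (R : ℝ) :
    IsCompact (F '' Metric.closedBall 0 R) := by
  set D : WeakDual ℝ H → H := fun φ => (InnerProductSpace.toDual ℝ H).symm φ.toStrongDual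
  have image_D : D '' (WeakDual.toStrongDual ⁻¹' Metric.closedBall 0 R) =
      Metric.closedBall 0 R := by
    ext h
    refine ⟨?_, fun hh => ⟨(InnerProductSpace.toDual ℝ H h).toWeakDual, ?_, ?_⟩⟩
    · rintro ⟨φ, hφ, rfl⟩
      simpa [D] using hφ
    · simpa using hh
    · simp [D]
  have coords_D (s : Finset ι) (φ : WeakDual ℝ H) :
      coords e s (j (D φ)) = WithLp.toLp 2 fun i : s => φ (dualToH j (e i)) := by
    ext i
    rw [coords_apply, ← inner_dualToH, real_inner_comm]
    exact InnerProductSpace.toDual_symm_apply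
  have continuousOn_F : ContinuousOn (fun φ => F (D φ))
      (WeakDual.toStrongDual ⁻¹' Metric.closedBall 0 R) := by
    refine continuousOn_of_uniform_approx_of_continuousOn fun u hu => ?_
    obtain ⟨η, hη, hηu⟩ := Metric.mem_uniformity_dist.1 hu
    obtain ⟨s, P, hP, hPF, -⟩ := (happ η hη R).exists
    refine ⟨fun φ => P (0, coords e s (j (D φ))), Continuous.continuousOn ?_, fun φ hφ => ?_⟩
    · simp only [coords_D]
      have (i : ι) : Continuous fun φ : WeakDual ℝ H => φ (dualToH j (e i)) :=
        WeakDual.eval_continuous _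
      exact hP.comp (continuous_const.prodMk
        ((PiLp.continuous_toLp 2 _).comp (continuous_pi fun i => this i)))
    · refine hηu ((dist_comm _ _).trans_lt (hPF _ ?_))
      simpa [D] using hφ
  rw [← image_D, Set.image_image]
  exact (WeakDual.isCompact_closedBall 0 R).image_of_continuousOn continuousOn_F

lemma isCompact_setOf_contractedRate_le [MetricSpace S] {X : ℝ → B → S} {F : H → S}
    (happ : HasExpApprox j μ e X F) (c : ℝ≥0) :
    IsCompact {y | contractedRate F y ≤ c} := by
  rw [setOf_contractedRate_le]
  exact (happ.isCompact_image_closedBall _).of_isClosed_subset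
    (isClosed_iInter fun n => (happ.isCompact_image_closedBall _).isClosed) (Set.iInter_subset _ 0)

variable [BorelSpace B]

theorem eventually_notMem_thickening_le [PseudoMetricSpace S] {X : ℝ → B → S} {F : H → S}
    (happ : HasExpApprox j μ e X F) (hμ : IsAbstractWienerSpace j μ)
    (hb : ∀ i, b i = dualToH j (e i)) {R a η : ℝ} (hR : 0 < R) (ha : a < R ^ 2 / 2) (hη : 0 < η) :
    ∀ᶠ ε in 𝓝[>] (0 : ℝ), μ {ξ | X ε ξ ∉ Metric.thickening η (F '' Metric.closedBall 0 R)}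
      ≤ ENNReal.ofReal (Real.exp (-a / ε)) := by
  obtain ⟨a₁, haa₁, ha₁⟩ := exists_between ha
  obtain ⟨s, P, hP, hPF, hXP⟩ := (happ (η / 3) (by positivity) (max R a₁)).exists
  have hP_unif := nhdsWithin_le_nhds (s := Set.Ioi 0)
    (eventually_dist_lt_of_norm_le hP (η := η / 3) (by positivity) R)
  have gaussian_tail :=
    eventually_stdGaussian_lt_norm_le (E := EuclideanSpace ℝ s) (by positivity) ha₁
  filter_upwards [hXP, hP_unif, gaussian_tail,
    eventually_const_mul_exp_le (A := 2) (by simp) haa₁, eventually_mem_nhdsWithin]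
    with ε hXPε hPε htail hexp (hε : 0 < ε)
  have subset_union : {ξ | X ε ξ ∉ Metric.thickening η (F '' Metric.closedBall 0 R)} ⊆
      {ξ | η / 3 ≤ dist (X ε ξ) (P (ε, √ε • coords e s ξ))} ∪
        coords e s ⁻¹' {z | R ^ 2 / 2 < ‖√ε • z‖ ^ 2 / 2} := by
    intro ξ hξ
    by_contra! hfar
    simp only [Set.mem_union, Set.mem_preimage, Set.mem_ofPred_eq, not_or, not_le, not_lt] at hfar
    obtain ⟨dist_XP, norm_sq_le⟩ := hfar
    have norm_le : ‖√ε • coords e s ξ‖ ≤ R := abs_le_of_sq_le_sq' (by linarith) hR.le |>.2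
    obtain ⟨h, coords_h, norm_h⟩ := exists_coords_eq hb s (√ε • coords e s ξ)
    have hR_h : ‖h‖ ≤ R := norm_h.trans_le norm_le
    have dist_PF := hPF h (hR_h.trans (le_max_left _ _))
    rw [coords_h] at dist_PF
    refine hξ (Metric.mem_thickening_iff.2 ⟨F h, ⟨h, by simpa using hR_h, rfl⟩, ?_⟩)
    linarith [hPε _ norm_le, dist_triangle4 (X ε ξ) (P (ε, √ε • coords e s ξ))
      (P (0, √ε • coords e s ξ)) (F h)]
  calc μ {ξ | X ε ξ ∉ Metric.thickening η (F '' Metric.closedBall 0 R)}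
      ≤ ENNReal.ofReal (Real.exp (-a₁ / ε)) + ENNReal.ofReal (Real.exp (-a₁ / ε)) := by
        refine (measure_mono subset_union).trans ((measure_union_le _ _).trans (add_le_add ?_ ?_))
        · refine hXPε.trans ?_
          gcongr
          exact le_max_right _ _
        · rwa [← Measure.map_apply (by fun_prop)
            (isOpen_lt continuous_const (by fun_prop)).measurableSet, hμ.map_coords hb]
    _ ≤ ENNReal.ofReal (Real.exp (-a / ε)) := by rwa [← two_mul]

theorem eventually_exp_le_dist_lt [PseudoMetricSpace S] {X : ℝ → B → S} {F : H → S}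
    (happ : HasExpApprox j μ e X F) (hμ : IsAbstractWienerSpace j μ)
    (hb : ∀ i, b i = dualToH j (e i)) {h : H} {a η : ℝ} (ha : ‖h‖ ^ 2 / 2 < a) (hη : 0 < η) :
    ∀ᶠ ε in 𝓝[>] (0 : ℝ), ENNReal.ofReal (Real.exp (-a / ε)) ≤ μ {ξ | dist (X ε ξ) (F h) < η} := by
  obtain ⟨a₁, ha₁, ha₁a⟩ := exists_between ha
  obtain ⟨s, P, hP, hPF, hXP⟩ := (happ (η / 3) (by positivity) (max ‖h‖ a)).exists
  set x := coords e s (j h)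
  have hx : ‖x‖ ^ 2 / 2 < a₁ := lt_of_le_of_lt (by grw [norm_coords_le hb s h]) ha₁
  obtain ⟨r, hr, hPr⟩ := Metric.continuousAt_iff.1 (hP.continuousAt (x := (0, x))) (η / 3)
    (by positivity)
  filter_upwards [hXP, Ioo_mem_nhdsGT hr,
    eventually_exp_le_stdGaussian_norm_sub_le hx (half_pos hr),
    eventually_const_mul_exp_le (A := 2) (by simp) ha₁a] with ε hXPε ⟨hε, hεr⟩ hball hexp
  have subset_union : coords e s ⁻¹' {z | ‖√ε • z - x‖ ≤ r / 2} ⊆ {ξ | dist (X ε ξ) (F h) < η} ∪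
      {ξ | η / 3 ≤ dist (X ε ξ) (P (ε, √ε • coords e s ξ))} := by
    intro ξ (hξ : ‖√ε • coords e s ξ - x‖ ≤ r / 2)
    refine or_iff_not_imp_right.2 fun hfar => ?_
    have dist_XP : dist (X ε ξ) (P (ε, √ε • coords e s ξ)) < η / 3 := not_le.1 hfar
    have dist_lt : dist (ε, √ε • coords e s ξ) (0, x) < r := by
      rw [Prod.dist_eq, max_lt_iff, Real.dist_0_eq_abs, abs_of_pos hε, dist_eq_norm]
      exact ⟨hεr, by linarith⟩
    have dist_PF := hPF h (le_max_left _ _)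
    change dist (X ε ξ) (F h) < η
    linarith [hPr dist_lt, dist_triangle4 (X ε ξ) (P (ε, √ε • coords e s ξ)) (P (0, x)) (F h)]
  refine (ENNReal.add_le_add_iff_right (ENNReal.ofReal_ne_top (r := Real.exp (-a / ε)))).1 ?_
  calc ENNReal.ofReal (Real.exp (-a / ε)) + ENNReal.ofReal (Real.exp (-a / ε))
      ≤ ENNReal.ofReal (Real.exp (-a₁ / ε)) := by rwa [← two_mul]
    _ ≤ μ (coords e s ⁻¹' {z | ‖√ε • z - x‖ ≤ r / 2}) := by
      rwa [← Measure.map_apply (by fun_prop)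
        (isClosed_le (by fun_prop) continuous_const).measurableSet, hμ.map_coords hb]
    _ ≤ μ {ξ | dist (X ε ξ) (F h) < η} + ENNReal.ofReal (Real.exp (-a / ε)) := by
      refine (measure_mono subset_union).trans ((measure_union_le _ _).trans ?_)
      gcongr
      refine hXPε.trans ?_
      gcongr
      exact le_max_right _ _

variable [MetricSpace S] {X : ℝ → B → S} {F : H → S}

lemma eventually_measure_closed_le (happ : HasExpApprox j μ e X F)
    (hμ : IsAbstractWienerSpace j μ) (hb : ∀ i, b i = dualToH j (e i)) {C : Set S}
    (hC : IsClosed C) {a : ℝ}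
    (ha : (a : EReal) < ((⨅ y ∈ C, contractedRate F y : ℝ≥0∞) : EReal)) :
    ∀ᶠ ε in 𝓝[>] (0 : ℝ), μ {ξ | X ε ξ ∈ C} ≤ ENNReal.ofReal (Real.exp (-a / ε)) := by
  have := hμ.isGaussian
  rcases lt_or_ge a 0 with ha_neg | ha_nonneg
  · filter_upwards [eventually_mem_nhdsWithin] with ε (hε : 0 < ε)
    exact prob_le_one.trans (ENNReal.one_le_ofReal.2
      (Real.one_le_exp (div_nonneg (neg_nonneg.2 ha_neg.le) hε.le)))
  obtain ⟨a₁, haa₁, ha₁⟩ := EReal.exists_between_coe_real ha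
  have haa₁ : a < a₁ := EReal.coe_lt_coe_iff.1 haa₁
  have ha₁_pos : 0 < a₁ := ha_nonneg.trans_lt haa₁
  have image_subset : F '' Metric.closedBall 0 √(2 * a₁) ⊆ Cᶜ := by
    rintro _ ⟨h, hh, rfl⟩
    refine notMem_of_lt_iInf_contractedRate ha₁ ?_
    have := (Real.le_sqrt (norm_nonneg _) (by positivity)).1 (mem_closedBall_zero_iff.1 hh)
    linarith
  obtain ⟨η, hη, thickening_subset⟩ := (happ.isCompact_image_closedBall _)
    |>.exists_thickening_subset_open hC.isOpen_compl image_subset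
  filter_upwards [happ.eventually_notMem_thickening_le hμ hb (R := √(2 * a₁)) (a := a)
    (by positivity) (by rw [Real.sq_sqrt (by positivity)]; linarith) hη] with ε hε
  refine (measure_mono fun ξ hξ => ?_).trans hε
  exact fun hthick => thickening_subset hthick hξ

lemma eventually_exp_le_measure_open (happ : HasExpApprox j μ e X F)
    (hμ : IsAbstractWienerSpace j μ) (hb : ∀ i, b i = dualToH j (e i)) {O : Set S}
    (hO : IsOpen O) {a : ℝ} (ha : ((⨅ y ∈ O, contractedRate F y : ℝ≥0∞) : EReal) < a) :
    ∀ᶠ ε in 𝓝[>] (0 : ℝ), ENNReal.ofReal (Real.exp (-a / ε)) ≤ μ {ξ | X ε ξ ∈ O} := by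
  obtain ⟨h, hhO, hha⟩ := exists_mem_of_iInf_contractedRate_lt ha
  obtain ⟨η, hη, ball_subset⟩ := Metric.isOpen_iff.1 hO _ hhO
  filter_upwards [happ.eventually_exp_le_dist_lt hμ hb hha hη] with ε hε
  exact hε.trans (measure_mono fun ξ hξ => ball_subset hξ)

theorem satisfiesLDP [MeasurableSpace S] [BorelSpace S] (happ : HasExpApprox j μ e X F)
    (hμ : IsAbstractWienerSpace j μ) (hb : ∀ i, b i = dualToH j (e i))
    (hX : ∀ ε > 0, AEMeasurable (X ε) μ) :
    SatisfiesLDP (fun ε => μ.map (X ε)) (contractedRate F) where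
  isProbabilityMeasure ε hε := by
    have := hμ.isGaussian
    exact Measure.isProbabilityMeasure_map (hX ε hε)
  lowerSemicontinuous := by
    rw [lowerSemicontinuous_iff_isClosed_preimage]
    intro c
    induction c with
    | top => simp
    | coe c => exact (happ.isCompact_setOf_contractedRate_le c).isClosed
  isCompact_sublevel := happ.isCompact_setOf_contractedRate_le
  exists_ne_top := ⟨F 0, ne_top_of_le_ne_top ENNReal.ofReal_ne_top (contractedRate_le F 0)⟩
  upper_bound C hC := by
    refine limsup_mul_log_le fun a ha => ?_
    filter_upwards [happ.eventually_measure_closed_le hμ hb hC ha, self_mem_nhdsWithin] with ε h hε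
    rwa [Measure.map_apply_of_aemeasurable (hX ε hε) hC.measurableSet]
  lower_bound O hO := by
    refine le_liminf_mul_log fun a ha => ?_
    filter_upwards [happ.eventually_exp_le_measure_open hμ hb hO ha, self_mem_nhdsWithin]
      with ε h hε
    rwa [Measure.map_apply_of_aemeasurable (hX ε hε) hO.measurableSet]

end HasExpApprox
end LargeDeviations

section ChaosApproximation

lemma norm_sub_sq_eq_integral {Ω F : Type*} [MeasurableSpace Ω] {μ : Measure Ω}
    [NormedAddCommGroup F] (f g : Lp F 2 μ) :
    ‖f - g‖ ^ 2 = ∫ ξ, ‖f ξ - g ξ‖ ^ 2 ∂μ := by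
  have enorm_eq (ξ : Ω) : ENNReal.ofReal (‖(f - g) ξ‖ ^ 2) = ‖(f - g) ξ‖ₑ ^ 2 := by
    rw [ENNReal.ofReal_pow (norm_nonneg _), ofReal_norm]
  calc ‖f - g‖ ^ 2 = (∫⁻ ξ, ENNReal.ofReal (‖(f - g) ξ‖ ^ 2) ∂μ).toReal := by
        simp only [enorm_eq, lintegral_enorm_sq_Lp, ENNReal.toReal_ofReal (sq_nonneg _)]
    _ = ∫ ξ, ‖(f - g) ξ‖ ^ 2 ∂μ :=
        (integral_eq_lintegral_of_nonneg_ae (.of_forall fun ξ => sq_nonneg _)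
          (AEStronglyMeasurable.fun_pow (Lp.aestronglyMeasurable (f - g)).norm 2)).symm
    _ = ∫ ξ, ‖f ξ - g ξ‖ ^ 2 ∂μ :=
        integral_congr_ae ((Lp.coeFn_sub f g).mono fun ξ hξ => by simp only [hξ, Pi.sub_apply])

lemma tendsto_Lp_of_tendsto_integral_norm_sub_sq {A Ω F : Type*} [MeasurableSpace Ω]
    {μ : Measure Ω} [NormedAddCommGroup F] {l : Filter A} {g : A → Lp F 2 μ} {f : Lp F 2 μ}
    (hg : Tendsto (fun a => ∫ ξ, ‖g a ξ - f ξ‖ ^ 2 ∂μ) l (𝓝 0)) : Tendsto g l (𝓝 f) := by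
  simp only [← norm_sub_sq_eq_integral] at hg
  simpa [tendsto_iff_norm_sub_tendsto_zero] using hg.sqrt

lemma aemeasurable_rescaled {Ω W : Type*} [MeasurableSpace Ω] {μ : Measure Ω} [Countable W]
    {E : W → Type*} [∀ τ, NormedAddCommGroup (E τ)] [∀ τ, NormedSpace ℝ (E τ)]
    [∀ τ, SecondCountableTopology (E τ)] [∀ τ, MeasurableSpace (E τ)] [∀ τ, BorelSpace (E τ)]
    (K : W → ℕ) (Ψ : ∀ τ, ℕ → Lp (E τ) 2 μ) (ε : ℝ) : AEMeasurable (rescaled K Ψ ε) μ :=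
  aemeasurable_pi_lambda _ fun τ =>
    (Finset.aemeasurable_fun_sum _ fun k _ => (Lp.aestronglyMeasurable (Ψ τ k)).aemeasurable)
      |>.const_smul _

variable {B H : Type*} [NormedAddCommGroup B] [NormedSpace ℝ B] [MeasurableSpace B] [BorelSpace B]
  [NormedAddCommGroup H] [InnerProductSpace ℝ H] [CompleteSpace H]
  {j : H →L[ℝ] B} {μ : Measure B} {ι : Type*} {e : ι → StrongDual ℝ B} {b : HilbertBasis ι ℝ H}

section

variable {F : Type*} [NormedAddCommGroup F] [NormedSpace ℝ F] [CompleteSpace F]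

lemma measure_lt_sqrt_pow_mul_norm_le (hμ : IsAbstractWienerSpace j μ)
    (hb : ∀ i, b i = dualToH j (e i)) {k : ℕ} {f : Lp F 2 μ} (hf : f ∈ chaos μ e F k) {M N ε : ℝ}
    (hM : 1 < M) (hfN : ‖f‖ < N) (hε : 0 < ε) (hε_one : ε < 1) :
    μ {ξ | 3 * M ^ k * N < √ε ^ k * ‖f ξ‖}
      ≤ 2 * ENNReal.ofReal (Real.exp (1 / 4)) * ENNReal.ofReal (Real.exp (-(M ^ 2 / 4) / ε)) := by
  have sqrt_pos : 0 < √ε := Real.sqrt_pos.2 hε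
  have one_lt : 1 < M / √ε := by
    rw [one_lt_div sqrt_pos]
    exact ((Real.sqrt_lt' one_pos).2 (by rwa [one_pow])).trans hM
  calc μ {ξ | 3 * M ^ k * N < √ε ^ k * ‖f ξ‖} = μ {ξ | 3 * (M / √ε) ^ k * N < ‖f ξ‖} := by
        congr with ξ
        rw [← div_lt_iff₀' (by positivity), div_pow]
        ring_nf
    _ ≤ 2 * ENNReal.ofReal (Real.exp (-(((M / √ε) ^ 2 - 1) / 4))) :=
        measure_lt_norm_le_of_mem_chaos hμ hb hf one_lt hfN
    _ = _ := by
        rw [mul_assoc, ← ENNReal.ofReal_mul (Real.exp_nonneg _), ← Real.exp_add, div_pow,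
          Real.sq_sqrt hε.le]
        ring_nf

variable [CompleteSpace B] [SecondCountableTopology B]

theorem hasExpApprox_chaos (hμ : IsAbstractWienerSpace j μ) (hb : ∀ i, b i = dualToH j (e i))
    {k : ℕ} {Ψ : ℝ → Lp F 2 μ} {f : Lp F 2 μ} (hΨ : ∀ᶠ ε in 𝓝[>] (0 : ℝ), Ψ ε ∈ chaos μ e F k)
    (hΨf : Tendsto Ψ (𝓝[>] 0) (𝓝 f)) :
    HasExpApprox j μ e (fun ε ξ => √ε ^ k • Ψ ε ξ) (fun h => ∫ ξ, f (ξ + j h) ∂μ) := by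
  intro η hη R
  have hf : f ∈ chaos μ e F k :=
    (Submodule.isClosed_topologicalClosure _).mem_of_tendsto hΨf hΨ
  obtain ⟨M, hM, hRM⟩ : ∃ M : ℝ, 1 < M ∧ R < M ^ 2 / 4 :=
    ⟨2 * (|R| + 1), by linarith [abs_nonneg R], by nlinarith [abs_nonneg R, le_abs_self R]⟩
  have eventually_mul_lt (A : ℝ) : ∀ᶠ N in 𝓝[>] (0 : ℝ), A * N < η :=
    nhdsWithin_le_nhds (((continuous_const_mul A).tendsto' 0 0 (mul_zero A)).eventually_lt_const hη)
  obtain ⟨N, hNη, hNη', hN : 0 < N⟩ := ((eventually_mul_lt (3 * M ^ k)).and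
    ((eventually_mul_lt (Real.exp (R ^ 2 / 2))).and eventually_mem_nhdsWithin)).exists
  obtain ⟨g, c, hgf, hgc⟩ := exists_seq_chaosSum_tendsto hf
  obtain ⟨n, hn : dist (g n) f < N⟩ := (hgf.eventually (Metric.ball_mem_nhds f hN)).exists
  obtain ⟨hg_chaos, hc, hg⟩ := hgc n
  filter_upwards [eventually_chaosSum_eq_hermiteComb e hc] with s ⟨hα, chaosSum_eq⟩
  set α : (ι →₀ ℕ) → s → ℕ := fun α i => α i
  have g_ae_eq : g n =ᵐ[μ] fun ξ => hermiteComb 1 α (c n) (coords e s ξ) :=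
    hg.trans (.of_forall chaosSum_eq)
  refine ⟨fun p => hermiteComb p.1 α (c n) p.2, by fun_prop, fun h hh => ?_, ?_⟩
  · simp only [← hμ.integral_add_eq_hermiteComb hb h g_ae_eq, dist_eq_norm]
    calc ‖∫ ξ, g n (ξ + j h) ∂μ - ∫ ξ, f (ξ + j h) ∂μ‖
        ≤ Real.exp (‖h‖ ^ 2 / 2) * ‖g n - f‖ := hμ.norm_integral_add_sub_le hb h _ _
      _ ≤ Real.exp (R ^ 2 / 2) * N := by
          rw [dist_eq_norm] at hn
          gcongr
      _ < η := hNη'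
  have norm_sub_lt : ∀ᶠ ε in 𝓝[>] (0 : ℝ), ‖Ψ ε - g n‖ < N := by
    refine (hΨf.sub_const (g n)).norm.eventually_lt_const ?_
    rwa [← dist_eq_norm, dist_comm]
  filter_upwards [hΨ, norm_sub_lt, Ioo_mem_nhdsGT one_pos, eventually_const_mul_exp_le
    (A := 2 * ENNReal.ofReal (Real.exp (1 / 4))) (by finiteness) hRM]
    with ε hΨε hε_norm ⟨hε, hε_one⟩ hexp
  refine (measure_mono_ae ?_).trans <| (measure_lt_sqrt_pow_mul_norm_le hμ hb
    (sub_mem hΨε hg_chaos) hM hε_norm hε hε_one).trans hexp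
  filter_upwards [Lp.coeFn_sub (Ψ ε) (g n), g_ae_eq] with ξ sub_ξ g_ξ (hξ : η ≤ dist _ _)
  have hermiteComb_eq := hermiteComb_sq_mul (c := c n) hα √ε 1 (coords e s ξ)
  rw [Real.sq_sqrt hε.le, mul_one, ← g_ξ] at hermiteComb_eq
  rw [hermiteComb_eq, dist_smul₀, dist_eq_norm, Real.norm_of_nonneg (by positivity)] at hξ
  change 3 * M ^ k * N < √ε ^ k * ‖(Ψ ε - g n) ξ‖
  rw [sub_ξ]
  exact hNη.trans_le hξ

-- The terms with `k < K` carry a positive power of `ε`, which removes them from the limit.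
lemma hasExpApprox_rpow_smul_sum (hμ : IsAbstractWienerSpace j μ)
    (hb : ∀ i, b i = dualToH j (e i)) {K : ℕ} {Ψ : ℝ → ℕ → Lp F 2 μ} {f : ℕ → Lp F 2 μ}
    (hΨ : ∀ k ≤ K, ∀ᶠ ε in 𝓝[>] (0 : ℝ), Ψ ε k ∈ chaos μ e F k)
    (hΨf : ∀ k ≤ K, Tendsto (Ψ · k) (𝓝[>] 0) (𝓝 (f k))) :
    HasExpApprox j μ e
      (fun ε ξ => ε ^ ((K : ℝ) / 2) • ∑ k ∈ Finset.range (K + 1), Ψ ε k ξ)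
      (fun h => ∫ ξ, f K (ξ + j h) ∂μ) := by
  have summand (k : Fin (K + 1)) : HasExpApprox j μ e
      (fun ε ξ => √ε ^ (K - k : ℕ) • √ε ^ (k : ℕ) • Ψ ε k ξ)
      (fun h => √0 ^ (K - k : ℕ) • ∫ ξ, f k (ξ + j h) ∂μ) := by
    refine (hasExpApprox_chaos hμ hb (hΨ k k.is_le) (hΨf k k.is_le)).smul
      (a := fun ε => √ε ^ (K - k : ℕ)) (by fun_prop) fun ε hε => ?_
    rw [Real.norm_of_nonneg (by positivity)]
    exact pow_le_one₀ (Real.sqrt_nonneg _) (Real.sqrt_le_one.2 hε.2)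
  have uniformContinuous_sum : UniformContinuous fun v : Fin (K + 1) → F => ∑ k, v k := by
    convert (∑ k : Fin (K + 1),
      ContinuousLinearMap.proj (R := ℝ) (φ := fun _ => F) k).uniformContinuous
    simp
  have sum_eq (h : H) : ∑ k : Fin (K + 1), √0 ^ (K - k : ℕ) • ∫ ξ, f k (ξ + j h) ∂μ
      = ∫ ξ, f K (ξ + j h) ∂μ := by
    rw [Fin.sum_univ_castSucc, Finset.sum_eq_zero fun k _ => ?_]
    · simp
    · simp [Nat.sub_ne_zero_of_lt k.is_lt]
  have approx := (HasExpApprox.pi summand).comp_uniformContinuous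
    (G := fun v : Fin (K + 1) → F => ∑ k, v k) uniformContinuous_sum
  simp only [sum_eq] at approx
  refine approx.congr_ae ?_
  filter_upwards [eventually_mem_nhdsWithin] with ε (hε : 0 < ε)
  refine .of_forall fun ξ => ?_
  simp only [Real.rpow_div_two_eq_sqrt _ hε.le, Real.rpow_natCast, Finset.smul_sum,
    Finset.sum_range, smul_smul, ← pow_add, Nat.sub_add_cancel (Fin.is_le _)]

end

variable {W : Type*} {E : W → Type*} [∀ τ, NormedAddCommGroup (E τ)] [∀ τ, NormedSpace ℝ (E τ)]

theorem hasExpApprox_rescaled [CompleteSpace B] [SecondCountableTopology B] [Fintype W]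
    [∀ τ, CompleteSpace (E τ)]
    (hμ : IsAbstractWienerSpace j μ) (hb : ∀ i, b i = dualToH j (e i)) {K : W → ℕ}
    {Ψ : ℝ → ∀ τ, ℕ → Lp (E τ) 2 μ} {Φ : ∀ τ, ℕ → Lp (E τ) 2 μ}
    (hΨ : ∀ τ, ∀ k ≤ K τ, ∀ᶠ ε in 𝓝[>] (0 : ℝ), Ψ ε τ k ∈ chaos μ e (E τ) k)
    (hΨΦ : ∀ τ, ∀ k ≤ K τ, Tendsto (Ψ · τ k) (𝓝[>] 0) (𝓝 (Φ τ k))) :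
    HasExpApprox j μ e (fun ε => rescaled K (Ψ ε) ε) (homPart j K Φ) :=
  HasExpApprox.pi fun τ => hasExpApprox_rpow_smul_sum hμ hb (hΨ τ) (hΨΦ τ)

end ChaosApproximation

end WienerChaos

end

/-- `Ψ δ τ k` is the `k`-th chaos component of `Ψ_{δ; τ}`; the limit is `Ψ 0`. -/
theorem theorem3p3
    {B H : Type*} [NormedAddCommGroup B] [NormedSpace ℝ B] [CompleteSpace B]
    [SecondCountableTopology B] [MeasurableSpace B] [BorelSpace B]
    [NormedAddCommGroup H] [InnerProductSpace ℝ H] [CompleteSpace H]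
    (j : H →L[ℝ] B) (μ : Measure B) (hμ : WienerChaos.IsAbstractWienerSpace j μ)
    {ι : Type*} (e : ι → StrongDual ℝ B) (b : HilbertBasis ι ℝ H)
    (hb : ∀ i, b i = WienerChaos.dualToH j (e i))
    {W : Type*} [Fintype W] (E : W → Type*) [∀ τ, NormedAddCommGroup (E τ)]
    [∀ τ, NormedSpace ℝ (E τ)] [∀ τ, CompleteSpace (E τ)]
    [∀ τ, SecondCountableTopology (E τ)] [∀ τ, MeasurableSpace (E τ)] [∀ τ, BorelSpace (E τ)]
    (K : W → ℕ) (Ψ : ℝ → ∀ τ, ℕ → Lp (E τ) 2 μ)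
    (hΨ : ∀ δ ∈ Set.Ico (0 : ℝ) 1, ∀ τ, ∀ k ≤ K τ, Ψ δ τ k ∈ WienerChaos.chaos μ e (E τ) k)
    (hconv : ∀ τ, ∀ k ≤ K τ,
      Tendsto (fun δ : ℝ => ∫ ξ, ‖Ψ δ τ k ξ - Ψ 0 τ k ξ‖ ^ 2 ∂μ) (𝓝[>] 0) (𝓝 0))
    (δ : ℝ → ℝ) (hδ_nonneg : ∀ ε, 0 < ε → 0 ≤ δ ε) (hδ : Tendsto δ (𝓝[>] 0) (𝓝 0)) :
    SatisfiesLDP (fun ε : ℝ => μ.map (WienerChaos.rescaled K (Ψ (δ ε)) ε))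
      (WienerChaos.rateFunction j K (Ψ 0)) := by
  have hδ_ge : Tendsto δ (𝓝[>] 0) (𝓝[≥] 0) :=
    tendsto_nhdsWithin_iff.2 ⟨hδ, eventually_mem_nhdsWithin.mono fun ε => hδ_nonneg ε⟩
  have mem_chaos (τ : W) (k : ℕ) (hk : k ≤ K τ) :
      ∀ᶠ ε in 𝓝[>] (0 : ℝ), Ψ (δ ε) τ k ∈ WienerChaos.chaos μ e (E τ) k := by
    filter_upwards [hδ_ge (Ico_mem_nhdsGE one_pos)] with ε hε using hΨ (δ ε) hε τ k hk
  have tendsto_Ψ (τ : W) (k : ℕ) (hk : k ≤ K τ) :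
      Tendsto (fun ε => Ψ (δ ε) τ k) (𝓝[>] 0) (𝓝 (Ψ 0 τ k)) := by
    have continuousWithinAt_zero : ContinuousWithinAt (Ψ · τ k) (Set.Ici 0) 0 :=
      continuousWithinAt_Ioi_iff_Ici.1
        (WienerChaos.tendsto_Lp_of_tendsto_integral_norm_sub_sq (hconv τ k hk))
    exact continuousWithinAt_zero.tendsto.comp hδ_ge
  exact (WienerChaos.hasExpApprox_rescaled hμ hb mem_chaos tendsto_Ψ).satisfiesLDP hμ hb
    fun ε _ => WienerChaos.aemeasurable_rescaled K (Ψ (δ ε)) ε
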